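/- Let $q$ be an odd prime power and let $\mathbb{F}_q$ be the field with $q$ elements. A polynomial $f \in \mathbb{F}_q[x]$ is a permutation polynomial (PP) of $\mathbb{F}_q$ if $c \mapsto f(c)$ is a permutation of $\mathbb{F}_q$; as usual, only polynomials of degree less than $q$ are considered (every function on $\mathbb{F}_q$ is represented by exactly one such polynomial). A PP $f$ of degree $n$ is normalised if it is monic, $f(0)=0$, and, when the characteristic of $\mathbb{F}_q$ does not divide $n$, the coefficient of $x^{n-1}$ is zero. There is a PP of $\mathbb{F}_q$ of degree $6$ (and less than $q$) if and only if $q \in \{9, 11, 27\}$. The normalised PPs of $\mathbb{F}_q$ of degree $6$ (and less than $q$) are exactly the following polynomials, where $2^{1/2}$ denotes either root of $x^2-2$ in $\mathbb{F}_9$ (both roots are allowed, the same root being used throughout one polynomial), and where the signs in each of (1)–(4) are either all upper or all lower: 1. $x^6 \pm 2x$, $q=11$; 2. $x^6 \pm 4x$, $q=11$; 3. $x^6 \pm a^2x^3+ax^2 \pm 5x$, $a$ a nonzero square, $q=11$; 4. $x^6 \pm 4a^2x^3+ax^2 \pm 4x$, $a$ not a square, $q=11$; 5. $x^6+a^2x^4+a^7bx^3+a^4x^2+a(2b+1)x$,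 $a\neq 0$, $b\in\{0,1,2^{1/2},1+2^{1/2}\}$, $q=9$; 6. $x^6+ax^5+2abx^4+(a^3+ab^2+2b^3)x^3+(2a^4+ab^3)x^2+(2a^5+a^4b+2ab^4)x$, $a\neq 0$, $b$ arbitrary, $q=9$; 7. $x^6+ax^5+2abx^4+(ab^2+2b^3+a^3\varphi)x^3+(ab^3+2a^4\varphi)x^2+(2^{1/2}a^5+2ab^4+a^4b\varphi)x$, $a\neq 0$, $b$ arbitrary, $\varphi=\pm(1-2^{1/2})$, $q=9$; 8. $x^6+ax^5+2abx^4+(2a^3+ab^2+2b^3)x^3+(a^4+ab^3)x^2+(2a^5+2^{1/2}a^5+2a^4b+2ab^4)x$, $a\neq 0$, $b$ arbitrary, $q=9$; 9. $x^6+ax^5+2abx^4+(ab^2+2b^3)x^3+(2a^4+ab^3)x^2+(a^4b+2ab^4)x$, $a\neq 0$, $b$ arbitrary, $q=27$. Here $a$ and $b$ range over $\mathbb{F}_q$, subject to the stated conditions. -/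

import Mathlib

open Polynomial

namespace DegSix

variable {F : Type*} [Field F]

/-- `f` is a permutation polynomial of `F`: the map `c ↦ f(c)` is a permutation of `F`. -/
def IsPermPoly (f : F[X]) : Prop :=
  Function.Bijective fun c : F => f.eval c

/-- A permutation polynomial is normalised if it is monic, vanishes at `0`, and, when the
characteristic does not divide its degree `n`, its coefficient of `x^(n-1)` is zero. -/
structure IsNormalised (f : F[X]) : Prop where
  isPermPoly : IsPermPoly f
  monic : f.Monic
  eval_zero : f.eval 0 = 0
  coeff_pred : ¬ ringChar F ∣ f.natDegree → f.coeff (f.natDegree - 1) = 0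

/-- The polynomial `x^6 + a₅ x^5 + a₄ x^4 + a₃ x^3 + a₂ x^2 + a₁ x`. -/
noncomputable def sextic (a₅ a₄ a₃ a₂ a₁ : F) : F[X] :=
  X ^ 6 + C a₅ * X ^ 5 + C a₄ * X ^ 4 + C a₃ * X ^ 3 + C a₂ * X ^ 2 + C a₁ * X

/-- `x^6 ± 2x`. -/
def Row1 (f : F[X]) : Prop :=
  f = sextic 0 0 0 0 2 ∨ f = sextic 0 0 0 0 (-2)

/-- `x^6 ± 4x`. -/
def Row2 (f : F[X]) : Prop :=
  f = sextic 0 0 0 0 4 ∨ f = sextic 0 0 0 0 (-4)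

/-- `x^6 ± a^2 x^3 + a x^2 ± 5x`, the two signs agreeing, `a` a nonzero square. -/
def Row3 (f : F[X]) : Prop :=
  ∃ a : F, a ≠ 0 ∧ IsSquare a ∧
    (f = sextic 0 0 (a ^ 2) a 5 ∨ f = sextic 0 0 (-a ^ 2) a (-5))

/-- `x^6 ± 4 a^2 x^3 + a x^2 ± 4x`, the two signs agreeing, `a` not a square. -/
def Row4 (f : F[X]) : Prop :=
  ∃ a : F, ¬ IsSquare a ∧
    (f = sextic 0 0 (4 * a ^ 2) a 4 ∨ f = sextic 0 0 (-(4 * a ^ 2)) a (-4))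

/-- `x^6 + a^2 x^4 + a^7 b x^3 + a^4 x^2 + a (2b+1) x`, with `a ≠ 0`, `b ∈ {0, 1, s, 1 + s}`,
where `s` is either square root of `2`. -/
def Row5 (f : F[X]) : Prop :=
  ∃ s a b : F, s ^ 2 = 2 ∧ a ≠ 0 ∧ (b = 0 ∨ b = 1 ∨ b = s ∨ b = 1 + s) ∧
    f = sextic 0 (a ^ 2) (a ^ 7 * b) (a ^ 4) (a * (2 * b + 1))

/-- `x^6 + a x^5 + 2ab x^4 + (a^3 + ab^2 + 2b^3) x^3 + (2a^4 + ab^3) x^2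
+ (2a^5 + a^4 b + 2ab^4) x`, with `a ≠ 0`. -/
def Row6 (f : F[X]) : Prop :=
  ∃ a b : F, a ≠ 0 ∧
    f = sextic a (2 * a * b) (a ^ 3 + a * b ^ 2 + 2 * b ^ 3) (2 * a ^ 4 + a * b ^ 3)
      (2 * a ^ 5 + a ^ 4 * b + 2 * a * b ^ 4)

/-- `x^6 + a x^5 + 2ab x^4 + (ab^2 + 2b^3 + a^3 φ) x^3 + (ab^3 + 2a^4 φ) x^2
+ (s a^5 + 2ab^4 + a^4 b φ) x`, with `a ≠ 0`, `φ = ±(1 - s)`, where `s` is either square root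
of `2` (the same one throughout). -/
def Row7 (f : F[X]) : Prop :=
  ∃ s φ a b : F, s ^ 2 = 2 ∧ (φ = 1 - s ∨ φ = -(1 - s)) ∧ a ≠ 0 ∧
    f = sextic a (2 * a * b) (a * b ^ 2 + 2 * b ^ 3 + a ^ 3 * φ) (a * b ^ 3 + 2 * a ^ 4 * φ)
      (s * a ^ 5 + 2 * a * b ^ 4 + a ^ 4 * b * φ)

/-- `x^6 + a x^5 + 2ab x^4 + (2a^3 + ab^2 + 2b^3) x^3 + (a^4 + ab^3) x^2
+ (2a^5 + s a^5 + 2a^4 b + 2ab^4) x`, with `a ≠ 0`, where `s` is either square root of `2`. -/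
def Row8 (f : F[X]) : Prop :=
  ∃ s a b : F, s ^ 2 = 2 ∧ a ≠ 0 ∧
    f = sextic a (2 * a * b) (2 * a ^ 3 + a * b ^ 2 + 2 * b ^ 3) (a ^ 4 + a * b ^ 3)
      (2 * a ^ 5 + s * a ^ 5 + 2 * a ^ 4 * b + 2 * a * b ^ 4)

/-- `x^6 + a x^5 + 2ab x^4 + (ab^2 + 2b^3) x^3 + (2a^4 + ab^3) x^2 + (a^4 b + 2ab^4) x`,
with `a ≠ 0`. -/
def Row9 (f : F[X]) : Prop :=
  ∃ a b : F, a ≠ 0 ∧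
    f = sextic a (2 * a * b) (a * b ^ 2 + 2 * b ^ 3) (2 * a ^ 4 + a * b ^ 3)
      (a ^ 4 * b + 2 * a * b ^ 4)

end DegSix

/-! The engine is the necessary half of Hermite's criterion: if `f` permutes `F` and `e < q - 1`,
then `∑ f(x)^e = 0`, so the coefficient of `x^(q-1)` in `f^e` vanishes when `f^e` has degree below
`2(q-1)`. For `6e = q - 1 + d` this is the coefficient of `x^d` in the `e`-th power of the
reciprocal polynomial, whose constant term is 1, so every small `d` gives an explicit equation
between the coefficients of `f`.

If `q ≡ 1 (mod 6)`, then `d = 0` gives `1 = 0`. If `q ≡ 5 (mod 6)`, translate away `x^5` and write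
`q + 1 = 6k`. Then `k = 1/6` in `F`, the binomial coefficients involved are fixed rationals, and `d
= 2, 8, 14, 20` give an overdetermined system: for `q ≥ 23` either `f` is a square up to a constant,
or `313 b^5 = 0` with `b ≠ 0`. Since primes congruent to 1 modulo 6 are not the characteristic, both
are impossible. There remain 11 and 17, checked exhaustively.

In characteristic 3, Frobenius makes high powers of the reciprocal sparse. When the coefficient of
`x^5` is nonzero, an affine change of variable with parameters `a, b` reduces to `x^6 + x^5 + c x^3
+ e x^2 + d x`; rows 6 to 9 are the orbits of the surviving normal forms. For `q ≥ 81` every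
candidate is a square up to a constant or fails to separate two points. For `q = 27` the equations
leave one normal form, which is verified to be a permutation. For `q = 9` a single relation precedes
a finite check. Isomorphism of finite fields of equal order carries explicit computations to `F`. -/

namespace DegSix

/-! ### Power sums and Hermite's criterion. -/

section Hermite

variable {F : Type*} [Field F] [Fintype F]

/-- The bound stops just before `2(q-1)`, the next exponent whose power sum is `-1`. -/
theorem sum_pow_eq_ite (i : ℕ) (hi : i < 2 * (Fintype.card F - 1)) :
    ∑ x : F, x ^ i = if i = Fintype.card F - 1 then -1 else 0 := by
  classical
  have hq : 1 < Fintype.card F := Fintype.one_lt_card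
  rcases lt_or_ge i (Fintype.card F - 1) with h | h
  · rw [if_neg h.ne, FiniteField.sum_pow_lt_card_sub_one F i h]
  obtain ⟨j, rfl⟩ := Nat.exists_eq_add_of_le h
  rcases Nat.eq_zero_or_pos j with rfl | hj
  · have : ∀ x : F, x ^ (Fintype.card F - 1 + 0) = 1 - if x = 0 then 1 else 0 := by
      intro x
      split_ifs with hx
      · subst hx
        rw [zero_pow (by omega)]; ring
      · rw [add_zero, FiniteField.pow_card_sub_one_eq_one x hx]; ring
    rw [if_pos (add_zero _), Finset.sum_congr rfl fun x _ => this x]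
    simp
  -- For `j > 0` the functions `x^(q-1+j)` and `x^j` agree everywhere, including at 0.
  · rw [if_neg (by omega), ← FiniteField.sum_pow_lt_card_sub_one F j (by omega)]
    refine Finset.sum_congr rfl fun x _ => ?_
    by_cases hx : x = 0
    · subst hx
      rw [zero_pow (by omega), zero_pow (by omega)]
    · rw [pow_add, FiniteField.pow_card_sub_one_eq_one x hx, one_mul]

theorem sum_eval_eq_neg_coeff (g : F[X]) (hg : g.natDegree < 2 * (Fintype.card F - 1)) :
    ∑ x : F, g.eval x = -g.coeff (Fintype.card F - 1) := by
  have hq : 1 < Fintype.card F := Fintype.one_lt_card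
  simp_rw [eval_eq_sum_range' hg]
  rw [Finset.sum_comm]
  simp_rw [← Finset.mul_sum]
  rw [Finset.sum_congr rfl fun i hi => by rw [sum_pow_eq_ite i (Finset.mem_range.1 hi)]]
  simp only [mul_ite, mul_neg, mul_one, mul_zero, Finset.sum_ite_eq', Finset.mem_range]
  rw [if_pos (by omega)]

/-- The necessary part of Hermite's criterion, for powers of small degree. -/
theorem IsPermPoly.coeff_pow_eq_zero {f : F[X]} (hf : IsPermPoly f) {e : ℕ}
    (he : e < Fintype.card F - 1) (hd : (f ^ e).natDegree < 2 * (Fintype.card F - 1)) :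
    (f ^ e).coeff (Fintype.card F - 1) = 0 := by
  have h := sum_eval_eq_neg_coeff (f ^ e) hd
  simp_rw [eval_pow] at h
  rw [hf.sum_comp (fun y => y ^ e), FiniteField.sum_pow_lt_card_sub_one F e he] at h
  simpa using h.symm

end Hermite

/-! ### Sextics and their reciprocals. -/

section Sextic

variable {F : Type*} [Field F]

/-- The reciprocal polynomial of `sextic`. -/
noncomputable def revSextic (a₅ a₄ a₃ a₂ a₁ : F) : F[X] :=
  1 + C a₅ * X + C a₄ * X ^ 2 + C a₃ * X ^ 3 + C a₂ * X ^ 4 + C a₁ * X ^ 5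

variable (a₅ a₄ a₃ a₂ a₁ : F)

theorem sextic_monic : (sextic a₅ a₄ a₃ a₂ a₁).Monic := by
  unfold sextic; monicity!

theorem sextic_natDegree : (sextic a₅ a₄ a₃ a₂ a₁).natDegree = 6 := by
  unfold sextic; compute_degree!

theorem sextic_eval (x : F) : (sextic a₅ a₄ a₃ a₂ a₁).eval x =
    x ^ 6 + a₅ * x ^ 5 + a₄ * x ^ 4 + a₃ * x ^ 3 + a₂ * x ^ 2 + a₁ * x := by
  simp [sextic]

theorem sextic_coeff_five : (sextic a₅ a₄ a₃ a₂ a₁).coeff 5 = a₅ := by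
  simp [sextic, coeff_X_pow]

theorem reverse_sextic : (sextic a₅ a₄ a₃ a₂ a₁).reverse = revSextic a₅ a₄ a₃ a₂ a₁ := by
  have h : ∀ (n : ℕ) (a : F), n ≤ 6 → reflect 6 (C a * X ^ n) = C a * X ^ (6 - n) := by
    intro n a hn
    rw [reflect_C_mul_X_pow, revAt_le hn]
  have h6 := h 6 1 le_rfl
  have h1 := h 1 a₁ (by norm_num)
  simp only [map_one, one_mul, pow_one] at h6 h1
  rw [reverse, sextic_natDegree]
  simp only [sextic, reflect_add, h6, h1, h _ _ (show 5 ≤ 6 by norm_num),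
    h _ _ (show 4 ≤ 6 by norm_num), h _ _ (show 3 ≤ 6 by norm_num),
    h _ _ (show 2 ≤ 6 by norm_num)]
  simp only [revSextic]
  norm_num

theorem reverse_pow_eq (f : F[X]) (n : ℕ) : (f ^ n).reverse = f.reverse ^ n := by
  induction n with
  | zero => simpa using reverse_C (1 : F)
  | succ n ih => rw [pow_succ, reverse_mul_of_domain, ih, pow_succ]

variable {a₅ a₄ a₃ a₂ a₁}

/-- Reversal turns the coefficient at `q - 1` into one of low degree `d`, so only a few terms of the
power matter, however large `q` is. -/
theorem coeff_revSextic_pow_eq_zero [Fintype F] (hf : IsPermPoly (sextic a₅ a₄ a₃ a₂ a₁))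
    {e d : ℕ} (hed : 6 * e = Fintype.card F - 1 + d) (hd : d < Fintype.card F - 1) :
    (revSextic a₅ a₄ a₃ a₂ a₁ ^ e).coeff d = 0 := by
  have hdeg : (sextic a₅ a₄ a₃ a₂ a₁ ^ e).natDegree = 6 * e := by
    rw [(sextic_monic a₅ a₄ a₃ a₂ a₁).natDegree_pow, sextic_natDegree, mul_comm]
  rw [← reverse_sextic, ← reverse_pow_eq, coeff_reverse, hdeg, revAt_le (by omega)]
  rw [show 6 * e - d = Fintype.card F - 1 by omega]
  exact hf.coeff_pow_eq_zero (by omega) (by omega)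

theorem isPermPoly_sextic_iff [Finite F] : IsPermPoly (sextic a₅ a₄ a₃ a₂ a₁) ↔
    Function.Injective fun x : F =>
      x ^ 6 + a₅ * x ^ 5 + a₄ * x ^ 4 + a₃ * x ^ 3 + a₂ * x ^ 2 + a₁ * x := by
  simp only [IsPermPoly, sextic_eval]
  exact Finite.injective_iff_bijective.symm

theorem IsPermPoly.sextic_inj (hf : IsPermPoly (sextic a₅ a₄ a₃ a₂ a₁)) {x y : F}
    (h : x ^ 6 + a₅ * x ^ 5 + a₄ * x ^ 4 + a₃ * x ^ 3 + a₂ * x ^ 2 + a₁ * x =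
      y ^ 6 + a₅ * y ^ 5 + a₄ * y ^ 4 + a₃ * y ^ 3 + a₂ * y ^ 2 + a₁ * y) : x = y :=
  hf.1 (by simpa only [sextic_eval] using h)

theorem eq_sextic {f : F[X]} (hm : f.Monic) (hd : f.natDegree = 6) (h0 : f.eval 0 = 0) :
    f = sextic (f.coeff 5) (f.coeff 4) (f.coeff 3) (f.coeff 2) (f.coeff 1) := by
  have h := f.as_sum_range_C_mul_X_pow
  have h6 : f.coeff 6 = 1 := by rw [← hd]; exact hm
  have h00 : f.coeff 0 = 0 := by rw [coeff_zero_eq_eval_zero, h0]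
  rw [hd] at h
  simp only [Finset.sum_range_succ, Finset.sum_range_zero, h6, h00] at h
  nth_rw 1 [h]
  simp only [sextic, map_one, map_zero]
  ring

/-- A polynomial all of whose values are squares, up to a shift, is not a permutation. -/
theorem not_isPermPoly_of_eval_add_eq_sq [Fintype F] (h2 : ringChar F ≠ 2) {f : F[X]}
    (t : F) (g : F → F) (h : ∀ x, f.eval x + t = g x ^ 2) : ¬ IsPermPoly f := by
  intro hf
  obtain ⟨a, ha⟩ := FiniteField.exists_nonsquare h2
  obtain ⟨x, hx⟩ := hf.2 (a - t)
  refine ha ⟨g x, ?_⟩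
  rw [← pow_two, ← h x]
  simp only at hx
  rw [hx]; ring

end Sextic

/-! ### Low coefficients of powers of the reciprocal. -/

section ModSix

variable {F : Type*} [Field F]

/-- The `r`-th binomial term starts in degree `3r`, so the number of relevant terms does not depend
on `n`. -/
theorem coeff_one_add_X_pow_mul_pow (h : F[X]) (n D : ℕ) :
    ((1 + X ^ 3 * h) ^ n).coeff D =
      ∑ r ∈ Finset.range (D / 3 + 1), (n.choose r : F) * (h ^ r).coeff (D - 3 * r) := by
  have key : ∀ r, ((X ^ 3 * h) ^ r * 1 ^ (n - r) * (n.choose r : F[X])).coeff D =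
      if 3 * r ≤ D then (n.choose r : F) * (h ^ r).coeff (D - 3 * r) else 0 := by
    intro r
    rw [one_pow, mul_one, mul_pow, ← pow_mul, ← C_eq_natCast, coeff_mul_C, coeff_X_pow_mul']
    split_ifs <;> ring
  rw [add_comm (1 : F[X]), add_pow, finsetSum_coeff]
  simp only [key]
  rw [← Finset.sum_filter]
  have hsub : (Finset.range (n + 1)).filter (fun r => 3 * r ≤ D) ⊆ Finset.range (D / 3 + 1) := by
    intro r hr
    simp only [Finset.mem_filter, Finset.mem_range] at hr ⊢
    omega
  refine Finset.sum_subset hsub fun r hr hr' => ?_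
  simp only [Finset.mem_filter, Finset.mem_range] at hr hr'
  rw [Nat.choose_eq_zero_of_lt (by omega), Nat.cast_zero, zero_mul]

theorem revSextic_eq_one_add (b c d : F) :
    revSextic 0 0 b c d = 1 + X ^ 3 * (C b + C c * X + C d * X ^ 2) := by
  simp only [revSextic, map_zero]; ring

/-- The coefficients of the powers of `b + c x + d x^2`, by recursion on the exponent. -/
def quadraticPowCoeff (b c d : F) : ℕ → ℕ → F
  | 0, 0 => 1
  | 0, _ + 1 => 0
  | r + 1, 0 => b * quadraticPowCoeff b c d r 0
  | r + 1, 1 => b * quadraticPowCoeff b c d r 1 + c * quadraticPowCoeff b c d r 0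
  | r + 1, n + 2 => b * quadraticPowCoeff b c d r (n + 2) + c * quadraticPowCoeff b c d r (n + 1) +
      d * quadraticPowCoeff b c d r n

variable (b c d : F)

theorem coeff_quadratic_pow (r n : ℕ) :
    ((C b + C c * X + C d * X ^ 2) ^ r).coeff n = quadraticPowCoeff b c d r n := by
  induction r generalizing n with
  | zero =>
    cases n with
    | zero => simp [quadraticPowCoeff]
    | succ n => simp [quadraticPowCoeff, coeff_one]
  | succ r ih =>
    have h : (C b + C c * X + C d * X ^ 2) ^ (r + 1) =
        C b * (C b + C c * X + C d * X ^ 2) ^ r + C c * ((C b + C c * X + C d * X ^ 2) ^ r * X ^ 1) +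
        C d * ((C b + C c * X + C d * X ^ 2) ^ r * X ^ 2) := by
      rw [pow_succ, pow_one]
      generalize (C b + C c * X + C d * X ^ 2) ^ r = p
      ring
    rw [h]
    simp only [coeff_add, coeff_C_mul, coeff_mul_X_pow', ih]
    rcases n with _ | _ | n
    · simp [quadraticPowCoeff]
    · simp [quadraticPowCoeff]
    · rw [if_pos (by omega), if_pos (by omega)]
      rfl

theorem coeff_revSextic_pow_eight (n : ℕ) : (revSextic 0 0 b c d ^ n).coeff 8 =
    n.choose 2 * (2 * b * d + c ^ 2) := by
  rw [revSextic_eq_one_add, coeff_one_add_X_pow_mul_pow]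
  simp only [coeff_quadratic_pow, Finset.sum_range_succ, Finset.sum_range_zero, Nat.reduceMul,
    Nat.reduceSub, Nat.reduceDiv, quadraticPowCoeff, mul_zero, add_zero, zero_add]
  ring

theorem coeff_revSextic_pow_fourteen (n : ℕ) : (revSextic 0 0 b c d ^ n).coeff 14 =
    n.choose 3 * (3 * c * d ^ 2) + n.choose 4 * (6 * b ^ 2 * c ^ 2 + 4 * b ^ 3 * d) := by
  rw [revSextic_eq_one_add, coeff_one_add_X_pow_mul_pow]
  simp only [coeff_quadratic_pow, Finset.sum_range_succ, Finset.sum_range_zero, Nat.reduceMul,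
    Nat.reduceSub, Nat.reduceDiv, quadraticPowCoeff, mul_zero, add_zero, zero_add]
  ring

theorem coeff_revSextic_pow_twenty (n : ℕ) : (revSextic 0 0 b c d ^ n).coeff 20 =
    n.choose 4 * d ^ 4 +
      n.choose 5 * (20 * b * c ^ 3 * d + 30 * b ^ 2 * c * d ^ 2 + c ^ 5) +
      n.choose 6 * (15 * b ^ 4 * c ^ 2 + 6 * b ^ 5 * d) := by
  rw [revSextic_eq_one_add, coeff_one_add_X_pow_mul_pow]
  simp only [coeff_quadratic_pow, Finset.sum_range_succ, Finset.sum_range_zero, Nat.reduceMul,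
    Nat.reduceSub, Nat.reduceDiv, quadraticPowCoeff, mul_zero, add_zero, zero_add]
  ring

theorem coeff_revSextic_pow_two (a : F) (n : ℕ) :
    (revSextic 0 a b c d ^ n).coeff 2 = n * a := by
  have h : revSextic 0 a b c d = 1 + X ^ 2 * (C a + C b * X + C c * X ^ 2 + C d * X ^ 3) := by
    simp only [revSextic, map_zero]; ring
  induction n with
  | zero => simp [coeff_one]
  | succ n ih =>
    have h0 : (revSextic 0 a b c d ^ n).coeff 0 = 1 := by
      simp [coeff_zero_eq_eval_zero, revSextic]
    rw [pow_succ]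
    nth_rw 2 [h]
    rw [mul_add, mul_one, coeff_add, ih, mul_left_comm, coeff_X_pow_mul', if_pos le_rfl,
      Nat.sub_self, mul_coeff_zero, h0]
    simp
    ring

end ModSix

/-! ### Invariance under field isomorphisms. -/

section Transport

variable {F K : Type*} [Field F] [Field K]

theorem sextic_map (e : F →+* K) (a₅ a₄ a₃ a₂ a₁ : F) :
    (sextic a₅ a₄ a₃ a₂ a₁).map e = sextic (e a₅) (e a₄) (e a₃) (e a₂) (e a₁) := by
  simp [sextic]

theorem isPermPoly_sextic_congr (e : F ≃+* K) (a₅ a₄ a₃ a₂ a₁ : F) :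
    IsPermPoly (sextic (e a₅) (e a₄) (e a₃) (e a₂) (e a₁)) ↔
      IsPermPoly (sextic a₅ a₄ a₃ a₂ a₁) := by
  have h : (fun x => (sextic (e a₅) (e a₄) (e a₃) (e a₂) (e a₁)).eval x) =
      e ∘ (fun x => (sextic a₅ a₄ a₃ a₂ a₁).eval x) ∘ e.symm := by
    funext x
    simp [sextic_eval]
  rw [IsPermPoly, h, e.bijective.of_comp_iff', Function.Bijective.of_comp_iff _ e.symm.bijective,
    IsPermPoly]

end Transport

/-! ### Characteristic prime to 6: nonexistence for large fields. -/

section ModSix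

variable {F : Type*} [Field F] [Fintype F]

/-- Every power of such an `l` is 1 modulo 6, so `l` cannot be the characteristic. -/
theorem natCast_ne_zero_of_mod_six {l : ℕ} (hl : l.Prime) (hl6 : l % 6 = 1)
    (hq : Fintype.card F % 6 = 5) : (l : F) ≠ 0 := by
  intro h
  obtain ⟨p, hp⟩ := CharP.exists F
  obtain ⟨n, hpp, hn⟩ := FiniteField.card F p
  have hpl : p = l := (Nat.prime_dvd_prime_iff_eq hpp hl).1 ((CharP.cast_eq_zero_iff F p l).1 h)
  rw [hn, hpl, Nat.pow_mod, hl6] at hq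
  simp at hq

/-- There is no sextic permutation polynomial if `6` divides the order of the unit group. -/
theorem not_isPermPoly_sextic_of_mod_six_eq_one (hq : Fintype.card F % 6 = 1)
    (a₅ a₄ a₃ a₂ a₁ : F) : ¬ IsPermPoly (sextic a₅ a₄ a₃ a₂ a₁) := by
  intro hf
  have h1 : 1 < Fintype.card F := Fintype.one_lt_card
  -- Here `6e = q - 1` exactly, and the coefficient is the constant term 1 of the reciprocal power.
  have h := coeff_revSextic_pow_eq_zero hf (e := (Fintype.card F - 1) / 6) (d := 0)
    (by omega) (by omega)
  simp [coeff_zero_eq_eval_zero, revSextic] at h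

omit [Fintype F] in
-- This recursion evaluates the binomial coefficients in `F` without dividing by factorials.
theorem cast_choose_succ (n r : ℕ) :
    ((r : F) + 1) * (n.choose (r + 1) : F) = ((n : F) - r) * (n.choose r : F) := by
  have h := congrArg (Nat.cast : ℕ → F) (Nat.choose_succ_right_eq n r)
  push_cast at h
  rcases le_or_gt r n with hr | hr
  · rw [Nat.cast_sub hr] at h
    linear_combination h
  · rw [Nat.choose_eq_zero_of_lt hr, Nat.choose_eq_zero_of_lt (by omega)]
    simp

variable {k : ℕ}

/-- Since `q = 0` in `F`, the exponent `k` acts as `1/6`. -/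
theorem six_mul_cast (hk : Fintype.card F + 1 = 6 * k) : 6 * (k : F) = 1 := by
  have h := congrArg (Nat.cast : ℕ → F) hk
  push_cast at h
  rw [FiniteField.cast_card_eq_zero] at h
  linear_combination -h

theorem ringChar_ne_two_of_six_mul (hk : Fintype.card F + 1 = 6 * k) : ringChar F ≠ 2 := by
  intro h
  have h2 : ((2 : ℕ) : F) = 0 := by rw [← h]; exact ringChar.Nat.cast_ringChar
  have := six_mul_cast hk
  push_cast at h2
  refine one_ne_zero (α := F) ?_
  linear_combination 3 * k * h2 - this

theorem coeff_four_eq_zero (hk : Fintype.card F + 1 = 6 * k) (h11 : 11 ≤ Fintype.card F)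
    {a b c d : F} (hf : IsPermPoly (sextic 0 a b c d)) : a = 0 := by
  have h := coeff_revSextic_pow_eq_zero hf (e := k) (d := 2) (by omega) (by omega)
  rw [coeff_revSextic_pow_two] at h
  linear_combination 6 * h - a * six_mul_cast hk

/-- The case `d = 8`: the factor `(k+1).choose 2` is `7/72`, nonzero because 7 is 1 modulo 6. -/
theorem two_mul_add_sq_eq_zero (hk : Fintype.card F + 1 = 6 * k) (h11 : 11 ≤ Fintype.card F)
    {b c d : F} (hf : IsPermPoly (sextic 0 0 b c d)) : 2 * b * d + c ^ 2 = 0 := by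
  have h := coeff_revSextic_pow_eq_zero hf (e := k + 1) (d := 8) (by omega) (by omega)
  rw [coeff_revSextic_pow_eight] at h
  have h1 := cast_choose_succ (F := F) (k + 1) 1
  have h6 := six_mul_cast hk
  have h7 := natCast_ne_zero_of_mod_six (F := F) (l := 7) (by norm_num) rfl (by omega)
  rw [Nat.choose_one_right] at h1
  push_cast at h1 h7
  refine (mul_eq_zero.1 h).resolve_left fun h0 => h7 ?_
  norm_num at h1
  rw [h0] at h1
  linear_combination -36 * h1 - (6 * (k : F) + 7) * h6

/-- The case `d = 14`, simplified by `c^2 = -2bd`. -/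
theorem nine_mul_add_eq_zero (hk : Fintype.card F + 1 = 6 * k) (h17 : 17 ≤ Fintype.card F)
    {b c d : F} (hf : IsPermPoly (sextic 0 0 b c d)) : 9 * c * d ^ 2 + 5 * b ^ 3 * d = 0 := by
  have h8 := two_mul_add_sq_eq_zero hk (by omega) hf
  have h := coeff_revSextic_pow_eq_zero hf (e := k + 2) (d := 14) (by omega) (by omega)
  rw [coeff_revSextic_pow_fourteen] at h
  have h1 := cast_choose_succ (F := F) (k + 2) 1
  have h2 := cast_choose_succ (F := F) (k + 2) 2
  have h3 := cast_choose_succ (F := F) (k + 2) 3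
  have h6 := six_mul_cast hk
  have h7 := natCast_ne_zero_of_mod_six (F := F) (l := 7) (by norm_num) rfl (by omega)
  have h13 := natCast_ne_zero_of_mod_six (F := F) (l := 13) (by norm_num) rfl (by omega)
  rw [Nat.choose_one_right] at h1
  push_cast at h1 h2 h3 h7 h13
  norm_num at h1 h2 h3
  generalize ((k + 2).choose 2 : F) = C2 at *
  generalize ((k + 2).choose 3 : F) = C3 at *
  generalize ((k + 2).choose 4 : F) = C4 at *
  -- With `k + 2 = 13/6`, `C2` is `(13/6)(7/6)/2`; the next ones follow by the recursion.
  have e2 : 72 * C2 = 91 := by linear_combination 36 * h1 + (6 * (k : F) + 19) * h6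
  have e3 : 18 * C3 = C2 := by linear_combination 6 * h2 + C2 * h6
  have e4 : 24 * C4 = -5 * C3 := by linear_combination 6 * h3 + C3 * h6
  have hC3 : C3 ≠ 0 := by
    intro h0
    refine mul_ne_zero h7 h13 ?_
    linear_combination -e2 - 72 * e3 + 72 * 18 * h0
  refine (mul_eq_zero.1 (?_ : (8 * C3) * _ = 0)).resolve_left
    (mul_ne_zero ?_ hC3)
  · linear_combination 24 * h - (6 * b ^ 2 * c ^ 2 + 4 * b ^ 3 * d) * e4 + 30 * C3 * b ^ 2 * h8
  -- Cubing `6k = 1` shows that 8 is invertible.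
  · intro h0
    refine one_ne_zero (α := F) ?_
    linear_combination (27 * (k : F) ^ 3) * h0 - (36 * (k : F) ^ 2 + 6 * k + 1) * h6

theorem not_isPermPoly_sextic_of_mod_six_eq_five (hk : Fintype.card F + 1 = 6 * k)
    (h23 : 23 ≤ Fintype.card F) (b c d : F) : ¬ IsPermPoly (sextic 0 0 b c d) := by
  intro hf
  have h6 := six_mul_cast hk
  have h60 : (6 : F) ≠ 0 := left_ne_zero_of_mul_eq_one h6
  have h20 : (2 : F) ≠ 0 := fun h => h60 (by linear_combination 3 * h)
  have h30 : (3 : F) ≠ 0 := fun h => h60 (by linear_combination 2 * h)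
  have h8 := two_mul_add_sq_eq_zero hk (by omega) hf
  have h14 := nine_mul_add_eq_zero hk (by omega) hf
  by_cases hd : d = 0
  · subst hd
    have hc : c = 0 := pow_eq_zero_iff (n := 2) two_ne_zero |>.1 (by linear_combination h8)
    subst hc
    -- Only `x^6 + b x^3` remains; complete the square.
    refine not_isPermPoly_of_eval_add_eq_sq (ringChar_ne_two_of_six_mul hk) ((b / 2) ^ 2)
      (fun x => x ^ 3 + b / 2) (fun x => ?_) hf
    rw [sextic_eval]
    field_simp
    ring
  have h14' : 9 * c * d + 5 * b ^ 3 = 0 :=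
    (mul_eq_zero.1 (by linear_combination h14 : d * (9 * c * d + 5 * b ^ 3) = 0)).resolve_left hd
  -- The relation at `d = 20` needs `20 < q - 1`, which is why 17 is treated separately.
  have h := coeff_revSextic_pow_eq_zero hf (e := k + 3) (d := 20) (by omega) (by omega)
  rw [coeff_revSextic_pow_twenty] at h
  have h1 := cast_choose_succ (F := F) (k + 3) 1
  have h2 := cast_choose_succ (F := F) (k + 3) 2
  have h3 := cast_choose_succ (F := F) (k + 3) 3
  have h4 := cast_choose_succ (F := F) (k + 3) 4
  have h5 := cast_choose_succ (F := F) (k + 3) 5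
  have h7 := natCast_ne_zero_of_mod_six (F := F) (l := 7) (by norm_num) rfl (by omega)
  have h13 := natCast_ne_zero_of_mod_six (F := F) (l := 13) (by norm_num) rfl (by omega)
  have h19 := natCast_ne_zero_of_mod_six (F := F) (l := 19) (by norm_num) rfl (by omega)
  have h313 := natCast_ne_zero_of_mod_six (F := F) (l := 313) (by norm_num) rfl (by omega)
  rw [Nat.choose_one_right] at h1
  push_cast at h1 h2 h3 h4 h5 h7 h13 h19 h313
  norm_num at h1 h2 h3 h4 h5
  generalize ((k + 3).choose 2 : F) = C2 at *
  generalize ((k + 3).choose 3 : F) = C3 at *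
  generalize ((k + 3).choose 4 : F) = C4 at *
  generalize ((k + 3).choose 5 : F) = C5 at *
  generalize ((k + 3).choose 6 : F) = C6 at *
  have e2 : 72 * C2 = 19 * 13 := by linear_combination 36 * h1 + (6 * (k : F) + 31) * h6
  have e3 : 18 * C3 = 7 * C2 := by linear_combination 6 * h2 + C2 * h6
  have e4 : 24 * C4 = C3 := by linear_combination 6 * h3 + C3 * h6
  have e5 : 30 * C5 = -5 * C4 := by linear_combination 6 * h4 + C4 * h6
  have e6 : 36 * C6 = -11 * C5 := by linear_combination 6 * h5 + C5 * h6
  have hC4 : C4 ≠ 0 := by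
    intro h0
    refine mul_ne_zero (mul_ne_zero h7 h13) h19 ?_
    linear_combination -7 * e2 - 72 * e3 - 72 * 18 * e4 + 72 * 18 * 24 * h0
  have hb : b ≠ 0 := by
    rintro rfl
    have hc : c = 0 := pow_eq_zero_iff (n := 2) two_ne_zero |>.1 (by linear_combination h8)
    subst hc
    refine mul_ne_zero hC4 (pow_ne_zero 4 hd) ?_
    linear_combination h
  -- Characteristic 5 is compatible with `q ≡ 5 (mod 6)` and must be excluded before cancelling 5 in
  -- `e5`.
  have h50 : (5 : F) ≠ 0 := by
    intro h0
    have hc : c = 0 := by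
      refine (mul_eq_zero.1 (?_ : (3 ^ 2 * d) * c = 0)).resolve_left
        (mul_ne_zero (pow_ne_zero 2 h30) hd)
      linear_combination h14' - b ^ 3 * h0
    refine mul_ne_zero (mul_ne_zero h20 hb) hd ?_
    rw [hc] at h8
    linear_combination h8
  have e5' : 6 * C5 = -C4 := mul_left_cancel₀ h50 (by linear_combination e5)
  have key : 9 * d ^ 3 + 9 * b ^ 2 * c * d - 11 * b ^ 5 = 0 := by
    refine (mul_eq_zero.1 (?_ : (24 * C4 * d) * _ = 0)).resolve_left ?_
    · linear_combination 216 * h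
        - 36 * (20 * b * c ^ 3 * d + 30 * b ^ 2 * c * d ^ 2 + c ^ 5) * e5'
        - 6 * (15 * b ^ 4 * c ^ 2 + 6 * b ^ 5 * d) * e6
        + 11 * (15 * b ^ 4 * c ^ 2 + 6 * b ^ 5 * d) * e5'
        + C4 * (36 * (20 * b * c * d + c ^ 3 - 2 * b * c * d) - 165 * b ^ 4) * h8
    · exact mul_ne_zero (mul_ne_zero (by
        rw [show (24 : F) = 2 * 2 * 6 by norm_num]
        exact mul_ne_zero (mul_ne_zero h20 h20) h60) hC4) hd
  -- Eliminate `c` from the relations at 8 and 14. Together with `9d^3 = 16b^5`, from `key` and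
  -- `h14'`, this gives `(288 + 25) b^5 = 0`.
  have key2 : 162 * d ^ 3 + 25 * b ^ 5 = 0 := by
    refine (mul_eq_zero.1 (?_ : b * _ = 0)).resolve_left hb
    linear_combination 81 * d ^ 2 * h8 - (9 * c * d - 5 * b ^ 3) * h14'
  refine mul_ne_zero h313 (pow_ne_zero 5 hb) ?_
  linear_combination key2 - 18 * key + 18 * b ^ 2 * h14'

end ModSix

/-! ### Exhaustive checks for 11 and 17. -/

section PrimeFields

set_option maxRecDepth 100000 in
theorem zmod_seventeen_collision : ∀ b c d : ZMod 17, 2 * b * d + c ^ 2 = 0 →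
    ∃ x y : ZMod 17, x ≠ y ∧ x ^ 6 + b * x ^ 3 + c * x ^ 2 + d * x =
      y ^ 6 + b * y ^ 3 + c * y ^ 2 + d * y := by
  decide +kernel

set_option maxRecDepth 100000 in
theorem zmod_eleven_injective_iff : ∀ b c d : ZMod 11, 2 * b * d + c ^ 2 = 0 →
    (∀ x y : ZMod 11, x ^ 6 + b * x ^ 3 + c * x ^ 2 + d * x =
      y ^ 6 + b * y ^ 3 + c * y ^ 2 + d * y → x = y) →
    (b = 0 ∧ c = 0 ∧ (d = 2 ∨ d = -2 ∨ d = 4 ∨ d = -4)) ∨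
    (c ≠ 0 ∧ (∃ r, c = r * r) ∧ (b = c ^ 2 ∧ d = 5 ∨ b = -c ^ 2 ∧ d = -5)) ∨
    ((¬ ∃ r, c = r * r) ∧ (b = 4 * c ^ 2 ∧ d = 4 ∨ b = -(4 * c ^ 2) ∧ d = -4)) := by
  decide +kernel

end PrimeFields

/-! ### Exhaustive checks in the field of nine elements. -/

section FieldNine

/-- A model of the field with nine elements: the quadratic extension `𝔽₃(√2)`. -/
abbrev FieldNine : Type := QuadraticAlgebra (ZMod 3) 2 0

instance : Fact (∀ r : ZMod 3, r ^ 2 ≠ 2 + 0 * r) := ⟨by decide⟩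

instance : Fintype FieldNine :=
  Fintype.ofEquiv _ (QuadraticAlgebra.equivProd (2 : ZMod 3) 0).symm

theorem card_fieldNine : Fintype.card FieldNine = 9 := by
  rw [Fintype.ofEquiv_card]; rfl

set_option synthInstance.maxHeartbeats 400000 in
set_option synthInstance.maxSize 4000 in
set_option maxRecDepth 100000 in
-- The normal form with `x^5`, in Horner form for cheap evaluation; the coefficient `2c` of `x^2` is
-- the one forced by `relation_of_card_nine`.
theorem fieldNine_of_injective_one : ∀ c d : FieldNine,
    (∀ x y : FieldNine,
      x * (d + x * (2 * c + x * (c + x * x * (1 + x)))) =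
      y * (d + y * (2 * c + y * (c + y * y * (1 + y)))) → x = y) →
    (c = 1 ∧ d = 2) ∨
    ∃ s : FieldNine, s * s = 2 ∧ (((c = 1 - s ∨ c = -(1 - s)) ∧ d = s) ∨ (c = 2 ∧ d = 2 + s)) := by
  decide +kernel

set_option synthInstance.maxHeartbeats 400000 in
set_option synthInstance.maxSize 4000 in
set_option maxRecDepth 100000 in
-- The case without `x^5`, where the coefficient of `x^2` is forced to be `a^2`; `t` is the
-- parameter called `a` in `Row5`.
theorem fieldNine_of_injective_zero : ∀ a b d : FieldNine, a ≠ 0 →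
    (∀ x y : FieldNine,
      x * (d + x * (a * a + x * (b + x * (a + x * x)))) =
      y * (d + y * (a * a + y * (b + y * (a + y * y)))) → x = y) →
    ∃ s : FieldNine, s * s = 2 ∧ ∃ t : FieldNine, t * t = a ∧ ∃ u : FieldNine,
      (u = 0 ∨ u = 1 ∨ u = s ∨ u = 1 + s) ∧ b = t ^ 7 * u ∧ d = t * (2 * u + 1) := by
  decide +kernel

set_option synthInstance.maxHeartbeats 400000 in
set_option synthInstance.maxSize 4000 in
set_option maxRecDepth 100000 in
theorem fieldNine_injective_zero : ∀ s : FieldNine, s * s = 2 → ∀ t : FieldNine, t ≠ 0 →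
    ∀ u : FieldNine, (u = 0 ∨ u = 1 ∨ u = s ∨ u = 1 + s) → ∀ x y : FieldNine,
      x * (t * (2 * u + 1) + x * (t ^ 4 + x * (t ^ 7 * u + x * (t ^ 2 + x * x)))) =
      y * (t * (2 * u + 1) + y * (t ^ 4 + y * (t ^ 7 * u + y * (t ^ 2 + y * y)))) → x = y := by
  decide +kernel

set_option synthInstance.maxHeartbeats 400000 in
set_option synthInstance.maxSize 4000 in
set_option maxRecDepth 100000 in
theorem fieldNine_injective_one : ∀ c d : FieldNine, ((c = 1 ∧ d = 2) ∨
    ∃ s : FieldNine, s * s = 2 ∧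
      (((c = 1 - s ∨ c = -(1 - s)) ∧ d = s) ∨ (c = 2 ∧ d = 2 + s))) →
    ∀ x y : FieldNine,
      x * (d + x * (2 * c + x * (c + x * x * (1 + x)))) =
      y * (d + y * (2 * c + y * (c + y * y * (1 + y)))) → x = y := by
  decide +kernel

end FieldNine

/-! ### Characteristic 3: relations from Hermite's criterion. -/

section CharThree

variable {F : Type*} [Field F]

/-- Modulo `X^(D+1)` the power is `1 + nα X^k`, so an unbounded exponent enters only through its
residue in `F`. -/
theorem coeff_mul_one_add_pow (p t : F[X]) (α : F) {k l D : ℕ} (hk : D < 2 * k) (hl : D < l)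
    (n : ℕ) : (p * (1 + C α * X ^ k + X ^ l * t) ^ n).coeff D =
      p.coeff D + n * α * if k ≤ D then p.coeff (D - k) else 0 := by
  have key : ∃ s, (1 + C α * X ^ k + X ^ l * t) ^ n = 1 + C (n * α) * X ^ k + X ^ (D + 1) * s := by
    obtain ⟨i, hi⟩ := Nat.exists_eq_add_of_lt hk
    obtain ⟨j, hj⟩ := Nat.exists_eq_add_of_lt hl
    have hX : (X : F[X]) ^ k * X ^ k = X ^ (D + 1) * X ^ i := by
      rw [← pow_add, ← pow_add]; congr 1; omega
    have hY : (X : F[X]) ^ l = X ^ (D + 1) * X ^ j := by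
      rw [← pow_add]; congr 1; omega
    rw [hY]
    induction n with
    | zero => exact ⟨0, by simp⟩
    | succ n ih =>
      obtain ⟨s, hs⟩ := ih
      refine ⟨X ^ j * t * (1 + C (n * α) * X ^ k) + C (n * α) * C α * X ^ i +
        s * (1 + C α * X ^ k + X ^ (D + 1) * X ^ j * t), ?_⟩
      rw [pow_succ, hs]
      simp only [Nat.cast_add, Nat.cast_one, add_mul, one_mul, C_add]
      linear_combination (C (n * α) * C α) * hX
  obtain ⟨s, hs⟩ := key
  rw [hs, show p * (1 + C (n * α) * X ^ k + X ^ (D + 1) * s) =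
    p + C (n * α) * (p * X ^ k) + (p * s) * X ^ (D + 1) by ring]
  simp only [coeff_add, coeff_C_mul, coeff_mul_X_pow']
  rw [if_neg (Nat.not_succ_le_self D), add_zero]

variable (a₅ a₄ a₃ a₂ a₁ : F)

theorem coeff_mul_revSextic (p : F[X]) (n : ℕ) : (p * revSextic a₅ a₄ a₃ a₂ a₁).coeff n =
    p.coeff n + a₅ * (if 1 ≤ n then p.coeff (n - 1) else 0) +
      a₄ * (if 2 ≤ n then p.coeff (n - 2) else 0) + a₃ * (if 3 ≤ n then p.coeff (n - 3) else 0) +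
      a₂ * (if 4 ≤ n then p.coeff (n - 4) else 0) + a₁ * (if 5 ≤ n then p.coeff (n - 5) else 0) := by
  rw [show p * revSextic a₅ a₄ a₃ a₂ a₁ = p + C a₅ * (p * X ^ 1) + C a₄ * (p * X ^ 2) +
    C a₃ * (p * X ^ 3) + C a₂ * (p * X ^ 4) + C a₁ * (p * X ^ 5) by rw [revSextic]; ring]
  simp only [coeff_add, coeff_C_mul, coeff_mul_X_pow']

theorem coeff_revSextic (n : ℕ) : (revSextic a₅ a₄ a₃ a₂ a₁).coeff n =
    if n = 0 then 1 else if n = 1 then a₅ else if n = 2 then a₄ else if n = 3 then a₃ else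
      if n = 4 then a₂ else if n = 5 then a₁ else 0 := by
  rcases n with _ | _ | _ | _ | _ | _ | n <;>
    simp [revSextic, coeff_one, coeff_X, coeff_X_pow, coeff_C_mul]

variable [CharP F 3]

theorem three_eq_zero : (3 : F) = 0 := by
  exact_mod_cast CharP.cast_eq_zero F 3

theorem revSextic_cube : revSextic a₅ a₄ a₃ a₂ a₁ ^ 3 =
    1 + C (a₅ ^ 3) * X ^ 3 + C (a₄ ^ 3) * X ^ 6 + C (a₃ ^ 3) * X ^ 9 + C (a₂ ^ 3) * X ^ 12 +
      C (a₁ ^ 3) * X ^ 15 := by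
  have : Fact (Nat.Prime 3) := ⟨Nat.prime_three⟩
  simp only [revSextic, add_pow_char, mul_pow, ← pow_mul, C_pow, one_pow]

theorem revSextic_pow_nine : revSextic a₅ a₄ a₃ a₂ a₁ ^ 9 =
    1 + C (a₅ ^ 9) * X ^ 9 + C (a₄ ^ 9) * X ^ 18 + C (a₃ ^ 9) * X ^ 27 + C (a₂ ^ 9) * X ^ 36 +
      C (a₁ ^ 9) * X ^ 45 := by
  have : Fact (Nat.Prime 3) := ⟨Nat.prime_three⟩
  rw [show 9 = 3 * 3 by rfl, pow_mul, revSextic_cube]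
  simp only [add_pow_char, mul_pow, ← pow_mul, C_pow, one_pow]

theorem coeff_mul_revSextic_cube (p : F[X]) (n : ℕ) :
    (p * revSextic a₅ a₄ a₃ a₂ a₁ ^ 3).coeff n =
    p.coeff n + a₅ ^ 3 * (if 3 ≤ n then p.coeff (n - 3) else 0) +
      a₄ ^ 3 * (if 6 ≤ n then p.coeff (n - 6) else 0) +
      a₃ ^ 3 * (if 9 ≤ n then p.coeff (n - 9) else 0) +
      a₂ ^ 3 * (if 12 ≤ n then p.coeff (n - 12) else 0) +
      a₁ ^ 3 * (if 15 ≤ n then p.coeff (n - 15) else 0) := by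
  rw [revSextic_cube, show p * (1 + C (a₅ ^ 3) * X ^ 3 + C (a₄ ^ 3) * X ^ 6 + C (a₃ ^ 3) * X ^ 9 +
    C (a₂ ^ 3) * X ^ 12 + C (a₁ ^ 3) * X ^ 15) = p + C (a₅ ^ 3) * (p * X ^ 3) +
    C (a₄ ^ 3) * (p * X ^ 6) + C (a₃ ^ 3) * (p * X ^ 9) + C (a₂ ^ 3) * (p * X ^ 12) +
    C (a₁ ^ 3) * (p * X ^ 15) by ring]
  simp only [coeff_add, coeff_C_mul, coeff_mul_X_pow']

variable {a₅ a₄ a₃ a₂ a₁} [Fintype F] {v : ℕ}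

/-- The exponent is `5 + 9v`, split so that all but a square is a power of the sparse cube. -/
theorem relation_four (hv : Fintype.card F = 27 * (2 * v + 1))
    (hf : IsPermPoly (sextic a₅ a₄ a₃ a₂ a₁)) :
    2 * a₂ + 2 * a₅ * a₃ + a₄ ^ 2 + 2 * a₅ ^ 4 = 0 := by
  have h := coeff_revSextic_pow_eq_zero hf (e := 2 + 3 * (1 + 3 * v)) (d := 4)
    (by omega) (by omega)
  rw [pow_add, pow_mul, revSextic_cube,
    show 1 + C (a₅ ^ 3) * X ^ 3 + C (a₄ ^ 3) * X ^ 6 + C (a₃ ^ 3) * X ^ 9 + C (a₂ ^ 3) * X ^ 12 +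
      C (a₁ ^ 3) * X ^ 15 = 1 + C (a₅ ^ 3) * X ^ 3 + X ^ 6 * (C (a₄ ^ 3) + C (a₃ ^ 3) * X ^ 3 +
      C (a₂ ^ 3) * X ^ 6 + C (a₁ ^ 3) * X ^ 9) by ring,
    coeff_mul_one_add_pow _ _ _ (by norm_num) (by norm_num), pow_two] at h
  simp [coeff_mul_revSextic, coeff_revSextic] at h
  linear_combination h - 2 * a₅ ^ 4 * v * three_eq_zero (F := F)

/-- The surviving `v` separates `q = 27` (`v = 0`) from larger powers of 3 (`v = 1` in `F`). -/
theorem relation_sixteen (hv : Fintype.card F = 27 * (2 * v + 1)) {c b : F}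
    (hf : IsPermPoly (sextic 1 0 c (2 * c + 2) b)) :
    c ^ 3 + 2 * c + 2 * b ^ 3 + v * (2 + c) = 0 := by
  have h := coeff_revSextic_pow_eq_zero hf (e := 7 + 9 * v) (d := 16)
    (by omega) (by omega)
  rw [show revSextic 1 0 c (2 * c + 2) b ^ (7 + 9 * v) = revSextic 1 0 c (2 * c + 2) b *
      revSextic 1 0 c (2 * c + 2) b ^ 3 * revSextic 1 0 c (2 * c + 2) b ^ 3 *
      (revSextic 1 0 c (2 * c + 2) b ^ 9) ^ v by ring, revSextic_pow_nine,
    show 1 + C (1 ^ 9) * X ^ 9 + C (0 ^ 9) * X ^ 18 + C (c ^ 9) * X ^ 27 +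
      C ((2 * c + 2) ^ 9) * X ^ 36 +
      C (b ^ 9) * X ^ 45 = 1 + C (1 ^ 9) * X ^ 9 + X ^ 18 * (C (0 ^ 9) + C (c ^ 9) * X ^ 9 +
      C ((2 * c + 2) ^ 9) * X ^ 18 + C (b ^ 9) * X ^ 27) by ring,
    coeff_mul_one_add_pow _ _ _ (by norm_num) (by norm_num)] at h
  simp [coeff_mul_revSextic_cube, coeff_revSextic] at h
  linear_combination h - (16 + 58 * c + c * v + 80 * c ^ 2 + 49 * c ^ 3 + 12 * c ^ 4 + v) *
    three_eq_zero (F := F)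

theorem relation_twentyTwo_of_zero (hv : Fintype.card F = 27 * (2 * v + 1)) {a b d : F}
    (hf : IsPermPoly (sextic 0 a b (a ^ 2) d)) : a * (a * b + d) ^ 4 = 0 := by
  have h := coeff_revSextic_pow_eq_zero hf (e := 8 + 9 * v) (d := 22)
    (by omega) (by omega)
  rw [show revSextic 0 a b (a ^ 2) d ^ (8 + 9 * v) = revSextic 0 a b (a ^ 2) d *
      revSextic 0 a b (a ^ 2) d * revSextic 0 a b (a ^ 2) d ^ 3 * revSextic 0 a b (a ^ 2) d ^ 3 *
      (revSextic 0 a b (a ^ 2) d ^ 9) ^ v by ring, revSextic_pow_nine,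
    show 1 + C (0 ^ 9) * X ^ 9 + C (a ^ 9) * X ^ 18 + C (b ^ 9) * X ^ 27 +
      C ((a ^ 2) ^ 9) * X ^ 36 +
      C (d ^ 9) * X ^ 45 = 1 + C (a ^ 9) * X ^ 18 + X ^ 27 * (C (b ^ 9) +
      C ((a ^ 2) ^ 9) * X ^ 9 + C (d ^ 9) * X ^ 18) by
        rw [zero_pow (by norm_num), C_0]; ring,
    coeff_mul_one_add_pow _ _ _ (by norm_num) (by norm_num)] at h
  simp [coeff_mul_revSextic_cube, coeff_mul_revSextic, coeff_revSextic] at h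
  linear_combination h - (a * d ^ 4 + a ^ 2 * b ^ 6 - 2 * a ^ 3 * b ^ 2 * d ^ 2 + a ^ 5 * b ^ 4 +
    a ^ 6 * d ^ 2 + 2 * a ^ 11 + a ^ 11 * v) * three_eq_zero (F := F)

theorem relation_twentyTwo_of_one (hv : Fintype.card F = 27) {c b : F}
    (hf : IsPermPoly (sextic 1 0 c (2 * c + 2) b)) (hb : b ^ 3 = c ^ 3 + 2 * c) :
    b ^ 2 = c ^ 3 + c ^ 2 + c := by
  have h := coeff_revSextic_pow_eq_zero hf (e := 8) (d := 22)
    (by omega) (by omega)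
  rw [show revSextic 1 0 c (2 * c + 2) b ^ 8 = revSextic 1 0 c (2 * c + 2) b *
      revSextic 1 0 c (2 * c + 2) b * revSextic 1 0 c (2 * c + 2) b ^ 3 *
      revSextic 1 0 c (2 * c + 2) b ^ 3 by ring] at h
  simp [coeff_mul_revSextic_cube, coeff_mul_revSextic, coeff_revSextic] at h
  linear_combination h - (8 + 20 * c + 8 * c ^ 2) * hb -
    (5 * b ^ 2 + 16 * b ^ 2 * c + 16 * b ^ 2 * c ^ 2 + 6 * b ^ 2 * c ^ 3 + 27 * c + 99 * c ^ 2 +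
      147 * c ^ 3 + 124 * c ^ 4 + 56 * c ^ 5 + 12 * c ^ 6 + 2 * c ^ 7) * three_eq_zero (F := F)

end CharThree

/-! ### Characteristic 3: excluding candidates. -/

section CharThreeNecessity

variable {F : Type*} [Field F] [Fintype F] [CharP F 3]

omit [Fintype F] in
theorem ringChar_ne_two_of_charP_three : ringChar F ≠ 2 := by
  rw [ringChar.eq F 3]; norm_num

theorem not_isPermPoly_sextic_zero_zero_zero (b d : F) : ¬ IsPermPoly (sextic 0 0 b 0 d) := by
  intro hf
  have : Fact (Nat.Prime 3) := ⟨Nat.prime_three⟩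
  have h3 := three_eq_zero (F := F)
  -- In characteristic 3, `f(t+1) - f(t) = 2t^3 + 1 + b + d`, which vanishes when `t^3 = 1 + b + d`.
  obtain ⟨t, ht⟩ := (bijective_frobenius F 3).2 (1 + b + d)
  rw [frobenius_def] at ht
  have h : t + 1 = t := by
    refine hf.sextic_inj ?_
    linear_combination 2 * ht + (2 * t ^ 5 + 5 * t ^ 4 + 6 * t ^ 3 + 5 * t ^ 2 + 2 * t + 1 + b +
      b * t + b * t ^ 2 + d) * h3
  simp at h

theorem not_isPermPoly_sextic_zero {v : ℕ} (hv : Fintype.card F = 27 * (2 * v + 1))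
    (a b c d : F) : ¬ IsPermPoly (sextic 0 a b c d) := by
  intro hf
  have h3 := three_eq_zero (F := F)
  have h4 := relation_four hv hf
  obtain rfl : c = a ^ 2 := by linear_combination -h4 + c * h3
  rcases mul_eq_zero.1 (relation_twentyTwo_of_zero hv hf) with ha | had
  · subst ha
    rw [zero_pow two_ne_zero] at hf
    exact not_isPermPoly_sextic_zero_zero_zero b d hf
  · have hd : a * b + d = 0 := pow_eq_zero_iff (by norm_num) |>.1 had
    refine not_isPermPoly_of_eval_add_eq_sq ringChar_ne_two_of_charP_three ((2 * b) ^ 2)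
      (fun x => x ^ 3 + 2 * a * x + 2 * b) (fun x => ?_) hf
    rw [sextic_eval]
    linear_combination hd * x - (a * x ^ 4 + a ^ 2 * x ^ 2 + b * x ^ 3 + 3 * a * b * x) * h3

theorem coeff_two_of_isPermPoly_sextic_one {v : ℕ} (hv : Fintype.card F = 27 * (2 * v + 1))
    {c e d : F} (hf : IsPermPoly (sextic 1 0 c e d)) : e = 2 * c + 2 := by
  linear_combination -relation_four hv hf + e * three_eq_zero (F := F)

theorem not_isPermPoly_sextic_one {v : ℕ} (hv : Fintype.card F = 27 * (2 * v + 1))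
    (hv1 : (v : F) = 1) (c e d : F) : ¬ IsPermPoly (sextic 1 0 c e d) := by
  intro hf
  have : Fact (Nat.Prime 3) := ⟨Nat.prime_three⟩
  have h3 := three_eq_zero (F := F)
  obtain rfl := coeff_two_of_isPermPoly_sextic_one hv hf
  have h16 := relation_sixteen hv hf
  rw [hv1] at h16
  -- The relation reads `d^3 = c^3 + 2 = (c + 2)^3`, and cubing is injective.
  obtain rfl : d = c + 2 := by
    refine (bijective_frobenius F 3).1 ?_
    rw [frobenius_def, frobenius_def]
    linear_combination -h16 + (d ^ 3 - 2 - 2 * c ^ 2 - 3 * c) * h3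
  refine not_isPermPoly_of_eval_add_eq_sq ringChar_ne_two_of_charP_three ((2 * c + 1) ^ 2)
    (fun x => x ^ 3 + 2 * x ^ 2 + x + (2 * c + 1)) (fun x => ?_) hf
  rw [sextic_eval]
  linear_combination -(x ^ 5 + 2 * x ^ 4 + (c + 2) * x ^ 3 + (2 * c + 1) * x ^ 2 + c * x) * h3

theorem eq_of_isPermPoly_sextic_one_of_card (hq : Fintype.card F = 27) {c e d : F}
    (hf : IsPermPoly (sextic 1 0 c e d)) : c = 0 ∧ e = 2 ∧ d = 0 := by
  have h3 := three_eq_zero (F := F)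
  have hv : Fintype.card F = 27 * (2 * 0 + 1) := by rw [hq]
  have he := coeff_two_of_isPermPoly_sextic_one hv hf
  subst he
  have h16 := relation_sixteen hv hf
  rw [Nat.cast_zero, zero_mul, add_zero] at h16
  have hb3 : d ^ 3 = c ^ 3 + 2 * c := by linear_combination -h16 + d ^ 3 * h3
  have hb2 := relation_twentyTwo_of_one hq hf hb3
  -- Eliminate `d` by comparing `(d^3)^2` with `(d^2)^3`.
  have hprod : c ^ 2 * (c - 1) ^ 2 * ((c ^ 2 + 1) * (c ^ 3 - c ^ 2 - c - 1)) = 0 := by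
    linear_combination (d ^ 3 + c ^ 3 + 2 * c) * hb3 -
      (d ^ 4 + d ^ 2 * (c ^ 3 + c ^ 2 + c) + (c ^ 3 + c ^ 2 + c) ^ 2) * hb2 -
      (-c ^ 2 + c ^ 5 + 3 * c ^ 6 + c ^ 7 + 2 * c ^ 8) * h3
  rcases mul_eq_zero.1 hprod with h | h
  · rcases mul_eq_zero.1 h with h | h
    · have hc : c = 0 := pow_eq_zero_iff two_ne_zero |>.1 h
      subst hc
      have hd : d = 0 := pow_eq_zero_iff two_ne_zero |>.1 (by linear_combination hb2)
      exact ⟨rfl, by ring, hd⟩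
    · have hc : c = 1 := by linear_combination pow_eq_zero_iff two_ne_zero |>.1 h
      subst hc
      have hd : d = 0 := pow_eq_zero_iff two_ne_zero |>.1 (by linear_combination hb2 + h3)
      subst hd
      -- For `c = 1` the polynomial vanishes at both `-1` and 0.
      have : (-1 : F) = 0 := hf.sextic_inj (by linear_combination h3)
      exact absurd (neg_eq_zero.1 this) one_ne_zero
  · exfalso
    rcases mul_eq_zero.1 h with h | h
    -- The field of 27 elements has no square root of `-1`.
    · have hpow : c ^ 27 = c := by rw [← hq]; exact FiniteField.pow_card c
      have h4 : c ^ 4 = 1 := by linear_combination (c ^ 2 - 1) * h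
      have hc : c = 0 := by
        have h27 : c ^ 27 = c ^ 3 := by
          rw [show c ^ 27 = (c ^ 4) ^ 6 * c ^ 3 by ring, h4]; ring
        linear_combination c * h3 - c * h - h27 + hpow
      rw [hc] at h
      exact one_ne_zero (α := F) (by linear_combination h)
    · have hd0 : d ≠ 0 := by
        rintro rfl
        have h1 : c ^ 2 + 1 = 0 := by linear_combination -hb3 - h - c * h3
        refine one_ne_zero (α := F) ?_
        linear_combination h1 + c * (c * h1 + hb3)
      have hd : d = c ^ 2 := by
        have : d ^ 2 * (d - c ^ 2) = 0 := by
          linear_combination hb3 - c ^ 2 * hb2 - c * (c + 2) * h - (c ^ 3 + c ^ 2) * h3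
        linear_combination (mul_eq_zero.1 this).resolve_left (pow_ne_zero 2 hd0)
      subst hd
      -- For a root `c` of the cubic, `c^2 - 1` is a second zero of the polynomial; it is nonzero by
      -- the cubic.
      have hroot : c ^ 2 - 1 = 0 := by
        refine hf.sextic_inj ?_
        linear_combination (31 + 22 * c + 10 * c ^ 2 + 4 * c ^ 4 + 7 * c ^ 5 - c ^ 6 - 3 * c ^ 7 +
          c ^ 8 + c ^ 9) * h + (11 + 18 * c + 19 * c ^ 2) * h3
      refine one_ne_zero (α := F) ?_
      linear_combination h3 - (c - 1) * hroot + h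

omit [CharP F 3] in
theorem relation_of_card_nine (hq : Fintype.card F = 9) {a₅ a₄ a₃ a₂ a₁ : F}
    (hf : IsPermPoly (sextic a₅ a₄ a₃ a₂ a₁)) : 2 * a₂ + 2 * a₅ * a₃ + a₄ ^ 2 = 0 := by
  have h := coeff_revSextic_pow_eq_zero hf (e := 2) (d := 4) (by omega) (by omega)
  rw [pow_two] at h
  simp [coeff_mul_revSextic, coeff_revSextic] at h
  linear_combination h

end CharThreeNecessity

/-! ### Affine normal forms. -/

section Normalisation

variable {F : Type*} [Field F]

/-- Affine substitutions of the variable act on sextics in characteristic three. -/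
theorem isPermPoly_sextic_affine [CharP F 3] {a : F} (ha : a ≠ 0) (b c e d : F) :
    IsPermPoly (sextic a (2 * a * b) (2 * b ^ 3 + a * b ^ 2 + c * a ^ 3) (a * b ^ 3 + e * a ^ 4)
      (2 * a * b ^ 4 + 2 * e * a ^ 4 * b + d * a ^ 5)) ↔ IsPermPoly (sextic 1 0 c e d) := by
  have h3 := three_eq_zero (F := F)
  have h : (fun x => (sextic a (2 * a * b) (2 * b ^ 3 + a * b ^ 2 + c * a ^ 3)
      (a * b ^ 3 + e * a ^ 4) (2 * a * b ^ 4 + 2 * e * a ^ 4 * b + d * a ^ 5)).eval x) =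
      -- With `g` the normal form, the polynomial is `a^6 (g((x + b)/a) - g(b/a))`.
      ((Equiv.mulLeft₀ (a ^ 6) (pow_ne_zero 6 ha)).trans
        (Equiv.addRight (-(a ^ 6 * (sextic 1 0 c e d).eval (b / a))))) ∘
      (fun x => (sextic 1 0 c e d).eval x) ∘
      ((Equiv.addRight b).trans (Equiv.divRight₀ a ha)) := by
    funext x
    simp only [Function.comp_apply, Equiv.trans_apply, Equiv.mulLeft₀_apply, Equiv.coe_addRight,
      Equiv.divRight₀_apply, sextic_eval]
    field_simp
    linear_combination -(x * a * b ^ 4 + x * a ^ 3 * b ^ 2 * c + 2 * x * b ^ 5 + 3 * x ^ 2 * a * b ^ 3 +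
      x ^ 2 * a ^ 3 * b * c + 5 * x ^ 2 * b ^ 4 + 3 * x ^ 3 * a * b ^ 2 + 6 * x ^ 3 * b ^ 3 +
      x ^ 4 * a * b + 5 * x ^ 4 * b ^ 2 + 2 * x ^ 5 * b) * h3
  rw [IsPermPoly, h, (Equiv.bijective _).of_comp_iff', Function.Bijective.of_comp_iff _
    (Equiv.bijective _), IsPermPoly]

theorem exists_affine_parameters [CharP F 3] {a₅ : F} (ha : a₅ ≠ 0) (a₄ a₃ a₂ a₁ : F) :
    ∃ b c e d, a₄ = 2 * a₅ * b ∧ a₃ = 2 * b ^ 3 + a₅ * b ^ 2 + c * a₅ ^ 3 ∧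
      a₂ = a₅ * b ^ 3 + e * a₅ ^ 4 ∧
      a₁ = 2 * a₅ * b ^ 4 + 2 * e * a₅ ^ 4 * b + d * a₅ ^ 5 := by
  have h3 := three_eq_zero (F := F)
  -- As `2 * 2 = 1`, this `b` solves `a₄ = 2 a₅ b`; the other equations are linear in `c`, `e`, `d`
  -- in turn.
  refine ⟨2 * a₄ / a₅, _, _, _, ?_, (sub_eq_iff_eq_add'.1 (div_mul_cancel₀ _ (pow_ne_zero 3 ha)).symm),
    (sub_eq_iff_eq_add'.1 (div_mul_cancel₀ _ (pow_ne_zero 4 ha)).symm),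
    (sub_eq_iff_eq_add'.1 (div_mul_cancel₀ _ (pow_ne_zero 5 ha)).symm)⟩
  field_simp
  linear_combination -a₄ * h3

theorem IsPermPoly.exists_monic_of_natDegree_six {f : F[X]} (hf : IsPermPoly f)
    (hd : f.natDegree = 6) : ∃ a₅ a₄ a₃ a₂ a₁, IsPermPoly (sextic a₅ a₄ a₃ a₂ a₁ : F[X]) := by
  have hl : f.leadingCoeff ≠ 0 := leadingCoeff_ne_zero.2 (by rintro rfl; simp at hd)
  have h6 : f.coeff 6 = f.leadingCoeff := by rw [leadingCoeff, hd]
  have hs := f.as_sum_range_C_mul_X_pow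
  rw [hd] at hs
  simp only [Finset.sum_range_succ, Finset.sum_range_zero, h6] at hs
  refine ⟨f.coeff 5 / f.leadingCoeff, f.coeff 4 / f.leadingCoeff, f.coeff 3 / f.leadingCoeff,
    f.coeff 2 / f.leadingCoeff, f.coeff 1 / f.leadingCoeff, ?_⟩
  have h : (fun x => (sextic (f.coeff 5 / f.leadingCoeff) (f.coeff 4 / f.leadingCoeff)
      (f.coeff 3 / f.leadingCoeff) (f.coeff 2 / f.leadingCoeff)
      (f.coeff 1 / f.leadingCoeff)).eval x) =
      ((Equiv.addRight (-f.coeff 0)).trans (Equiv.divRight₀ f.leadingCoeff hl)) ∘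
        fun x => f.eval x := by
    funext x
    have hx := congrArg (eval x) hs
    simp only [eval_add, eval_mul, eval_C, eval_pow, eval_X, eval_zero] at hx
    simp only [Function.comp_apply, Equiv.trans_apply, Equiv.coe_addRight, Equiv.divRight₀_apply,
      sextic_eval, hx]
    field_simp
    ring
  rw [IsPermPoly, h]
  exact (Equiv.bijective _).comp hf

/-- If `6` is invertible then a translation removes the term of degree five. -/
theorem IsPermPoly.exists_sextic_zero (h6 : (6 : F) ≠ 0) {a₅ a₄ a₃ a₂ a₁ : F}
    (hf : IsPermPoly (sextic a₅ a₄ a₃ a₂ a₁)) :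
    ∃ a b c d, IsPermPoly (sextic 0 a b c d : F[X]) := by
  obtain ⟨t, rfl⟩ : ∃ t, a₅ = -6 * t := ⟨-a₅ / 6, by field_simp⟩
  refine ⟨15 * t ^ 2 + 5 * (-6 * t) * t + a₄,
    20 * t ^ 3 + 10 * (-6 * t) * t ^ 2 + 4 * a₄ * t + a₃,
    15 * t ^ 4 + 10 * (-6 * t) * t ^ 3 + 6 * a₄ * t ^ 2 + 3 * a₃ * t + a₂,
    6 * t ^ 5 + 5 * (-6 * t) * t ^ 4 + 4 * a₄ * t ^ 3 + 3 * a₃ * t ^ 2 + 2 * a₂ * t + a₁, ?_⟩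
  have h : (fun x => (sextic 0 (15 * t ^ 2 + 5 * (-6 * t) * t + a₄)
      (20 * t ^ 3 + 10 * (-6 * t) * t ^ 2 + 4 * a₄ * t + a₃)
      (15 * t ^ 4 + 10 * (-6 * t) * t ^ 3 + 6 * a₄ * t ^ 2 + 3 * a₃ * t + a₂)
      (6 * t ^ 5 + 5 * (-6 * t) * t ^ 4 + 4 * a₄ * t ^ 3 + 3 * a₃ * t ^ 2 + 2 * a₂ * t +
        a₁)).eval x) =
      Equiv.addRight (-(sextic (-6 * t) a₄ a₃ a₂ a₁).eval t) ∘
        (fun x => (sextic (-6 * t) a₄ a₃ a₂ a₁).eval x) ∘ Equiv.addRight t := by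
    funext x
    simp only [Function.comp_apply, Equiv.coe_addRight, sextic_eval]
    ring
  rw [IsPermPoly, h]
  exact (Equiv.bijective _).comp (hf.comp (Equiv.bijective _))

end Normalisation

/-! ### A permutation sextic of the field of 27 elements. -/

section FieldTwentySeven

/-- Addition of triples of coordinates. -/
def addTriple (u v : ZMod 3 × ZMod 3 × ZMod 3) : ZMod 3 × ZMod 3 × ZMod 3 :=
  (u.1 + v.1, u.2.1 + v.2.1, u.2.2 + v.2.2)

/-- Multiplication in the basis `1, θ, θ²`, where `θ³ = θ + 1`. -/
def mulTriple (u v : ZMod 3 × ZMod 3 × ZMod 3) : ZMod 3 × ZMod 3 × ZMod 3 :=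
  (u.1 * v.1 + (u.2.1 * v.2.2 + u.2.2 * v.2.1),
    u.1 * v.2.1 + u.2.1 * v.1 + (u.2.1 * v.2.2 + u.2.2 * v.2.1) + u.2.2 * v.2.2,
    u.1 * v.2.2 + u.2.1 * v.2.1 + u.2.2 * v.1 + u.2.2 * v.2.2)

set_option maxRecDepth 100000 in
theorem exists_mulTriple_eq_one : ∀ u : ZMod 3 × ZMod 3 × ZMod 3, u ≠ (0, 0, 0) →
    ∃ v, mulTriple u v = (1, 0, 0) := by
  decide +kernel

set_option maxRecDepth 100000 in
theorem exists_triple_sextic_eq : ∀ w : ZMod 3 × ZMod 3 × ZMod 3, ∃ z,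
    mulTriple (mulTriple z z) (addTriple (mulTriple (mulTriple (mulTriple z z) z)
      (addTriple z (1, 0, 0))) (2, 0, 0)) = w := by
  decide +kernel

variable {F : Type*} [Field F] [CharP F 3]

/-- The element with given coordinates. -/
noncomputable def ofTriple (θ : F) (u : ZMod 3 × ZMod 3 × ZMod 3) : F :=
  ZMod.castHom (dvd_refl 3) F u.1 + ZMod.castHom (dvd_refl 3) F u.2.1 * θ +
    ZMod.castHom (dvd_refl 3) F u.2.2 * θ ^ 2

theorem ofTriple_add (θ : F) (u v : ZMod 3 × ZMod 3 × ZMod 3) :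
    ofTriple θ (addTriple u v) = ofTriple θ u + ofTriple θ v := by
  simp only [ofTriple, addTriple, map_add]; ring

theorem ofTriple_mul {θ : F} (hθ : θ ^ 3 = θ + 1) (u v : ZMod 3 × ZMod 3 × ZMod 3) :
    ofTriple θ (mulTriple u v) = ofTriple θ u * ofTriple θ v := by
  simp only [ofTriple, mulTriple, map_add, map_mul]
  generalize ZMod.castHom (dvd_refl 3) F u.1 = a
  generalize ZMod.castHom (dvd_refl 3) F u.2.1 = b
  generalize ZMod.castHom (dvd_refl 3) F u.2.2 = c
  generalize ZMod.castHom (dvd_refl 3) F v.1 = a'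
  generalize ZMod.castHom (dvd_refl 3) F v.2.1 = b'
  generalize ZMod.castHom (dvd_refl 3) F v.2.2 = c'
  linear_combination -(b * c' + c * b' + c * c' * θ) * hθ

/-- A nonzero triple has an inverse for `mulTriple`, so it cannot map to 0. -/
theorem ofTriple_injective {θ : F} (hθ : θ ^ 3 = θ + 1) : Function.Injective (ofTriple θ) := by
  intro u v huv
  have h0 : ofTriple θ (u - v) = 0 := by
    rw [← sub_eq_zero] at huv
    rw [← huv]
    simp only [ofTriple, Prod.fst_sub, Prod.snd_sub, map_sub]
    ring
  by_contra hne
  obtain ⟨w, hw⟩ := exists_mulTriple_eq_one (u - v) (sub_ne_zero.2 hne)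
  have h := congrArg (ofTriple θ) hw
  rw [ofTriple_mul hθ, h0, zero_mul] at h
  simp [ofTriple] at h

variable [Fintype F]

/-- An Artin–Schreier argument: the trace `w = x^9 + x^3 + x` has degree below 27, so it is nonzero
at some `x`. It satisfies `w^3 = w`, and `y = x^3 - x` has `y^3 - y = w`, so `θ = wy` gives `θ^3 - θ
= w^2 = 1`. -/
theorem exists_cube_eq_add_one (hq : Fintype.card F = 27) : ∃ θ : F, θ ^ 3 = θ + 1 := by
  have h3 := three_eq_zero (F := F)
  have hdeg : (X ^ 9 + X ^ 3 + X : F[X]).natDegree = 9 := by compute_degree!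
  obtain ⟨x, hx⟩ := exists_eval_ne_zero_of_natDegree_lt_card (X ^ 9 + X ^ 3 + X : F[X])
    (by intro h; rw [h] at hdeg; simp at hdeg)
    (by rw [hdeg, Cardinal.mk_fintype, hq]; norm_num)
  simp only [eval_add, eval_pow, eval_X] at hx
  have hx27 : x ^ 27 = x := by rw [← hq]; exact FiniteField.pow_card x
  have : Fact (Nat.Prime 3) := ⟨Nat.prime_three⟩
  have hw3 : (x ^ 9 + x ^ 3 + x) ^ 3 = x ^ 9 + x ^ 3 + x := by
    simp only [add_pow_char, ← pow_mul]
    linear_combination hx27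
  have hy : (x ^ 3 - x) ^ 3 - (x ^ 3 - x) = x ^ 9 + x ^ 3 + x := by
    linear_combination (x ^ 5 - x ^ 7 - x ^ 3) * h3
  generalize x ^ 9 + x ^ 3 + x = w at *
  generalize x ^ 3 - x = y at *
  have hw2 : w ^ 2 = 1 := by
    refine mul_left_cancel₀ hx ?_
    linear_combination hw3
  exact ⟨w * y, by linear_combination y ^ 3 * hw3 + w * hy + hw2⟩

theorem isPermPoly_sextic_of_card_twentySeven (hq : Fintype.card F = 27) :
    IsPermPoly (sextic 1 0 0 2 0 : F[X]) := by
  obtain ⟨θ, hθ⟩ := exists_cube_eq_add_one (F := F) hq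
  have hs : Function.Surjective (ofTriple θ) :=
    ((Fintype.bijective_iff_injective_and_card _).2
      ⟨ofTriple_injective hθ, by rw [hq]; rfl⟩).2
  refine Finite.surjective_iff_bijective.1 fun y => ?_
  obtain ⟨w, rfl⟩ := hs y
  obtain ⟨z, rfl⟩ := exists_triple_sextic_eq w
  refine ⟨ofTriple θ z, ?_⟩
  simp only [sextic_eval, ofTriple_mul hθ, ofTriple_add]
  have h1 : ofTriple θ (1, 0, 0) = 1 := by simp [ofTriple]
  have h2 : ofTriple θ (2, 0, 0) = 2 := by
    simp only [ofTriple, map_zero, map_ofNat]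
    ring
  rw [h1, h2]
  ring

end FieldTwentySeven

/-! ### The table under field isomorphisms. -/

section Rows

variable {F K : Type*} [Field F] [Field K]

theorem Row1.map (e : F ≃+* K) {f : F[X]} (h : Row1 f) : Row1 (f.map (e : F →+* K)) := by
  rcases h with rfl | rfl
  · left; simp [sextic_map, map_ofNat e]
  · right; simp [sextic_map, map_ofNat e]

theorem Row2.map (e : F ≃+* K) {f : F[X]} (h : Row2 f) : Row2 (f.map (e : F →+* K)) := by
  rcases h with rfl | rfl
  · left; simp [sextic_map, map_ofNat e]
  · right; simp [sextic_map, map_ofNat e]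

theorem Row3.map (e : F ≃+* K) {f : F[X]} (h : Row3 f) : Row3 (f.map (e : F →+* K)) := by
  obtain ⟨a, ha, hs, h⟩ := h
  refine ⟨e a, by simpa using ha, hs.map e, ?_⟩
  rcases h with rfl | rfl
  · left; simp [sextic_map, map_ofNat e]
  · right; simp [sextic_map, map_ofNat e]

theorem Row4.map (e : F ≃+* K) {f : F[X]} (h : Row4 f) : Row4 (f.map (e : F →+* K)) := by
  obtain ⟨a, ha, h⟩ := h
  refine ⟨e a, fun hs => ha (by simpa using hs.map e.symm), ?_⟩
  rcases h with rfl | rfl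
  · left; simp [sextic_map, map_ofNat e]
  · right; simp [sextic_map, map_ofNat e]

theorem Row5.map (e : F ≃+* K) {f : F[X]} (h : Row5 f) : Row5 (f.map (e : F →+* K)) := by
  obtain ⟨s, a, b, hs, ha, hb, rfl⟩ := h
  refine ⟨e s, e a, e b, ?_, by simpa using ha, ?_, by simp [sextic_map, map_ofNat e]⟩
  · rw [← map_pow, hs, map_ofNat]
  · rcases hb with rfl | rfl | rfl | rfl <;> simp

theorem Row6.map (e : F ≃+* K) {f : F[X]} (h : Row6 f) : Row6 (f.map (e : F →+* K)) := by
  obtain ⟨a, b, ha, rfl⟩ := h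
  exact ⟨e a, e b, by simpa using ha, by simp [sextic_map, map_ofNat e]⟩

theorem Row7.map (e : F ≃+* K) {f : F[X]} (h : Row7 f) : Row7 (f.map (e : F →+* K)) := by
  obtain ⟨s, φ, a, b, hs, hφ, ha, rfl⟩ := h
  refine ⟨e s, e φ, e a, e b, ?_, ?_, by simpa using ha, by simp [sextic_map, map_ofNat e]⟩
  · rw [← map_pow, hs, map_ofNat]
  · rcases hφ with rfl | rfl <;> simp

theorem Row8.map (e : F ≃+* K) {f : F[X]} (h : Row8 f) : Row8 (f.map (e : F →+* K)) := by
  obtain ⟨s, a, b, hs, ha, rfl⟩ := h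
  refine ⟨e s, e a, e b, ?_, by simpa using ha, by simp [sextic_map, map_ofNat e]⟩
  rw [← map_pow, hs, map_ofNat]

/-- A property of polynomials that is stable under field isomorphisms transfers back. -/
theorem of_map_ringEquiv {P : F[X] → Prop} {Q : K[X] → Prop} (e : F ≃+* K)
    (hPQ : ∀ g, Q g → P (g.map (e.symm : K →+* F))) {f : F[X]} (h : Q (f.map (e : F →+* K))) :
    P f := by
  have h' := hPQ _ h
  rwa [Polynomial.map_map, RingEquiv.symm_comp, Polynomial.map_id] at h'

theorem isPermPoly_sextic_map (e : F ≃+* K) (a₅ a₄ a₃ a₂ a₁ : F) :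
    IsPermPoly ((sextic a₅ a₄ a₃ a₂ a₁).map (e : F →+* K)) ↔
      IsPermPoly (sextic a₅ a₄ a₃ a₂ a₁) := by
  rw [sextic_map]
  exact isPermPoly_sextic_congr e a₅ a₄ a₃ a₂ a₁

end Rows

/-! ### The fields of 11 and 17 elements. -/

section RowsEleven

/-- The four families over the field with eleven elements. -/
def RowsEleven {F : Type*} [Field F] (f : F[X]) : Prop := Row1 f ∨ Row2 f ∨ Row3 f ∨ Row4 f

theorem RowsEleven.map {F K : Type*} [Field F] [Field K] (e : F ≃+* K) {f : F[X]}
    (h : RowsEleven f) : RowsEleven (f.map (e : F →+* K)) :=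
  h.imp (Row1.map e) (Or.imp (Row2.map e) (Or.imp (Row3.map e) (Row4.map e)))

instance : Fact (Nat.Prime 11) := ⟨by norm_num⟩
instance : Fact (Nat.Prime 17) := ⟨by norm_num⟩

theorem RowsEleven.exists_eq_sextic {F : Type*} [Field F] {f : F[X]} (h : RowsEleven f) :
    ∃ b c d, f = sextic 0 0 b c d := by
  rcases h with (h | h) | (h | h) | ⟨a, -, -, h | h⟩ | ⟨a, -, h | h⟩ <;> exact ⟨_, _, _, h⟩

theorem zmod_eleven_rows {b c d : ZMod 11} (hf : IsPermPoly (sextic 0 0 b c d)) :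
    RowsEleven (sextic 0 0 b c d) := by
  have h := two_mul_add_sq_eq_zero (k := 2) (by simp) (by simp) hf
  have h' := zmod_eleven_injective_iff b c d h fun x y hxy => hf.sextic_inj (by
    simpa using hxy)
  rcases h' with ⟨rfl, rfl, rfl | rfl | rfl | rfl⟩ | ⟨hc, hs, ⟨rfl, rfl⟩ | ⟨rfl, rfl⟩⟩ |
    ⟨hs, ⟨rfl, rfl⟩ | ⟨rfl, rfl⟩⟩
  · exact .inl (.inl rfl)
  · exact .inl (.inr rfl)
  · exact .inr (.inl (.inl rfl))
  · exact .inr (.inl (.inr rfl))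
  · exact .inr (.inr (.inl ⟨c, hc, hs, .inl rfl⟩))
  · exact .inr (.inr (.inl ⟨c, hc, hs, .inr rfl⟩))
  · exact .inr (.inr (.inr ⟨c, hs, .inl rfl⟩))
  · exact .inr (.inr (.inr ⟨c, hs, .inr rfl⟩))

set_option maxRecDepth 100000 in
theorem zmod_eleven_injective : ∀ b c d : ZMod 11,
    (b = 0 ∧ c = 0 ∧ (d = 2 ∨ d = -2 ∨ d = 4 ∨ d = -4)) ∨
    (c ≠ 0 ∧ (∃ r, c = r * r) ∧ (b = c ^ 2 ∧ d = 5 ∨ b = -c ^ 2 ∧ d = -5)) ∨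
    ((¬ ∃ r, c = r * r) ∧ (b = 4 * c ^ 2 ∧ d = 4 ∨ b = -(4 * c ^ 2) ∧ d = -4)) →
    ∀ x y : ZMod 11, x ^ 6 + b * x ^ 3 + c * x ^ 2 + d * x =
      y ^ 6 + b * y ^ 3 + c * y ^ 2 + d * y → x = y := by
  decide +kernel

theorem zmod_eleven_isPermPoly {f : (ZMod 11)[X]} (h : RowsEleven f) : IsPermPoly f := by
  have key : ∀ b c d : ZMod 11, _ → IsPermPoly (sextic 0 0 b c d) := fun b c d h =>
    isPermPoly_sextic_iff.2 fun x y hxy => zmod_eleven_injective b c d h x y (by simpa using hxy)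
  rcases h with (rfl | rfl) | (rfl | rfl) | ⟨a, h0, hs, rfl | rfl⟩ | ⟨a, hs, rfl | rfl⟩
  · exact key _ _ _ (.inl ⟨rfl, rfl, .inl rfl⟩)
  · exact key _ _ _ (.inl ⟨rfl, rfl, .inr (.inl rfl)⟩)
  · exact key _ _ _ (.inl ⟨rfl, rfl, .inr (.inr (.inl rfl))⟩)
  · exact key _ _ _ (.inl ⟨rfl, rfl, .inr (.inr (.inr rfl))⟩)
  · exact key _ _ _ (.inr (.inl ⟨h0, hs, .inl ⟨rfl, rfl⟩⟩))
  · exact key _ _ _ (.inr (.inl ⟨h0, hs, .inr ⟨rfl, rfl⟩⟩))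
  · exact key _ _ _ (.inr (.inr ⟨hs, .inl ⟨rfl, rfl⟩⟩))
  · exact key _ _ _ (.inr (.inr ⟨hs, .inr ⟨rfl, rfl⟩⟩))

variable {F : Type*} [Field F] [Fintype F]

theorem isPermPoly_sextic_iff_rowsEleven (hq : Fintype.card F = 11) (b c d : F) :
    IsPermPoly (sextic 0 0 b c d) ↔ RowsEleven (sextic 0 0 b c d) := by
  have e : F ≃+* ZMod 11 := FiniteField.ringEquivOfCardEq (by rw [hq, ZMod.card])
  refine ⟨fun h => of_map_ringEquiv e (fun g hg => RowsEleven.map e.symm hg) ?_, fun h => ?_⟩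
  · rw [← isPermPoly_sextic_map e, sextic_map, map_zero] at h
    rw [sextic_map, map_zero]
    exact zmod_eleven_rows h
  · rw [← isPermPoly_sextic_map e]
    exact zmod_eleven_isPermPoly (h.map e)

theorem not_isPermPoly_sextic_of_card_seventeen (hq : Fintype.card F = 17) (b c d : F) :
    ¬ IsPermPoly (sextic 0 0 b c d) := by
  intro hf
  have e : F ≃+* ZMod 17 := FiniteField.ringEquivOfCardEq (by rw [hq, ZMod.card])
  rw [← isPermPoly_sextic_map e, sextic_map, map_zero] at hf
  have h := two_mul_add_sq_eq_zero (k := 3) (by simp) (by simp) hf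
  obtain ⟨x, y, hxy, h⟩ := zmod_seventeen_collision _ _ _ h
  exact hxy (hf.sextic_inj (by simpa using h))

end RowsEleven

/-! ### The field of nine elements. -/

section RowsNine

/-- The four families over the field with nine elements. -/
def RowsNine {F : Type*} [Field F] (f : F[X]) : Prop := Row5 f ∨ Row6 f ∨ Row7 f ∨ Row8 f

theorem RowsNine.map {F K : Type*} [Field F] [Field K] (e : F ≃+* K) {f : F[X]}
    (h : RowsNine f) : RowsNine (f.map (e : F →+* K)) :=
  h.imp (Row5.map e) (Or.imp (Row6.map e) (Or.imp (Row7.map e) (Row8.map e)))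

theorem RowsNine.exists_eq_sextic {F : Type*} [Field F] {f : F[X]} (h : RowsNine f) :
    ∃ a₅ a₄ a₃ a₂ a₁, f = sextic a₅ a₄ a₃ a₂ a₁ := by
  rcases h with ⟨_, _, _, _, _, _, h⟩ | ⟨_, _, _, h⟩ | ⟨_, _, _, _, _, _, _, h⟩ |
    ⟨_, _, _, _, _, h⟩ <;> exact ⟨_, _, _, _, _, h⟩

theorem charP_three_of_card {F : Type*} [Field F] [Fintype F] {n : ℕ}
    (h : Fintype.card F = 3 ^ n) : CharP F 3 :=
  have : Fact (Nat.Prime 3) := ⟨Nat.prime_three⟩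
  charP_of_card_eq_prime_pow h

/-- The condition on the normal forms `x^6 + x^5 + c x^3 + 2c x^2 + d x`. -/
def BaseNine {F : Type*} [Field F] (c d : F) : Prop :=
  (c = 1 ∧ d = 2) ∨
    ∃ s : F, s * s = 2 ∧ (((c = 1 - s ∨ c = -(1 - s)) ∧ d = s) ∨ (c = 2 ∧ d = 2 + s))

section Affine

variable {F : Type*} [Field F] [CharP F 3]

theorem BaseNine.rowsNine {a c d : F} (h : BaseNine c d) (ha : a ≠ 0) (b : F) :
    RowsNine (sextic a (2 * a * b) (2 * b ^ 3 + a * b ^ 2 + c * a ^ 3)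
      (a * b ^ 3 + 2 * c * a ^ 4) (2 * a * b ^ 4 + 2 * (2 * c) * a ^ 4 * b + d * a ^ 5)) := by
  have h3 := three_eq_zero (F := F)
  rcases h with ⟨rfl, rfl⟩ | ⟨s, hs, ⟨hc, rfl⟩ | ⟨rfl, rfl⟩⟩
  · refine .inr (.inl ⟨a, b, ha, ?_⟩)
    congr 1
    · ring
    · ring
    · linear_combination a ^ 4 * b * h3
  · refine .inr (.inr (.inl ⟨d, c, a, b, by rw [pow_two, hs], hc, ha, ?_⟩))
    congr 1
    · ring
    · ring
    · linear_combination a ^ 4 * b * c * h3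
  · refine .inr (.inr (.inr ⟨s, a, b, by rw [pow_two, hs], ha, ?_⟩))
    congr 1
    · ring
    · linear_combination a ^ 4 * h3
    · linear_combination 2 * a ^ 4 * b * h3

theorem RowsNine.row5_or_base {f : F[X]} (h : RowsNine f) :
    Row5 f ∨ ∃ a b c d, a ≠ 0 ∧ BaseNine c d ∧
      f = sextic a (2 * a * b) (2 * b ^ 3 + a * b ^ 2 + c * a ^ 3)
      (a * b ^ 3 + 2 * c * a ^ 4) (2 * a * b ^ 4 + 2 * (2 * c) * a ^ 4 * b + d * a ^ 5) := by
  have h3 := three_eq_zero (F := F)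
  rcases h with h | ⟨a, b, ha, rfl⟩ | ⟨s, φ, a, b, hs, hφ, ha, rfl⟩ | ⟨s, a, b, hs, ha, rfl⟩
  · exact .inl h
  · refine .inr ⟨a, b, 1, 2, ha, .inl ⟨rfl, rfl⟩, ?_⟩
    congr 1
    · ring
    · ring
    · linear_combination -a ^ 4 * b * h3
  · refine .inr ⟨a, b, φ, s, ha, .inr ⟨s, by rw [← pow_two, hs], .inl ⟨hφ, rfl⟩⟩, ?_⟩
    congr 1
    · ring
    · ring
    · linear_combination -a ^ 4 * b * φ * h3
  · refine .inr ⟨a, b, 2, 2 + s, ha, .inr ⟨s, by rw [← pow_two, hs], .inr ⟨rfl, rfl⟩⟩, ?_⟩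
    congr 1
    · ring
    · linear_combination -a ^ 4 * h3
    · linear_combination -2 * a ^ 4 * b * h3

end Affine

instance : CharP FieldNine 3 := charP_three_of_card (n := 2) card_fieldNine

theorem fieldNine_rows {a₅ a₄ a₃ a₂ a₁ : FieldNine} (hf : IsPermPoly (sextic a₅ a₄ a₃ a₂ a₁)) :
    RowsNine (sextic a₅ a₄ a₃ a₂ a₁) := by
  have h3 := three_eq_zero (F := FieldNine)
  by_cases h5 : a₅ = 0
  · subst h5
    have hr := relation_of_card_nine card_fieldNine hf
    obtain rfl : a₂ = a₄ ^ 2 := by linear_combination -hr + a₂ * h3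
    by_cases h4 : a₄ = 0
    · subst h4
      rw [zero_pow two_ne_zero] at hf
      exact absurd hf (not_isPermPoly_sextic_zero_zero_zero _ _)
    obtain ⟨s, hs, t, rfl, u, hu, rfl, rfl⟩ := fieldNine_of_injective_zero a₄ a₃ a₁ h4
      fun x y hxy => hf.sextic_inj (by linear_combination hxy)
    have ht : t ≠ 0 := by rintro rfl; exact h4 (zero_mul 0)
    refine .inl ⟨s, t, u, by rw [pow_two, hs], ht, hu, ?_⟩
    rw [← pow_two, ← pow_mul]
  · obtain ⟨b, c, e, d, rfl, rfl, rfl, rfl⟩ := exists_affine_parameters h5 a₄ a₃ a₂ a₁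
    rw [isPermPoly_sextic_affine h5] at hf
    have hr := relation_of_card_nine card_fieldNine hf
    obtain rfl : e = 2 * c := by linear_combination -hr + e * h3
    exact BaseNine.rowsNine (fieldNine_of_injective_one c d fun x y hxy => hf.sextic_inj (by
      linear_combination hxy)) h5 b

theorem fieldNine_isPermPoly {f : FieldNine[X]} (h : RowsNine f) : IsPermPoly f := by
  rcases h.row5_or_base with ⟨s, a, b, hs, ha, hb, rfl⟩ | ⟨a, b, c, d, ha, hb, rfl⟩
  · exact isPermPoly_sextic_iff.2 fun x y hxy => fieldNine_injective_zero s
      (by rw [← pow_two, hs]) a ha b hb x y (by linear_combination hxy)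
  · refine (isPermPoly_sextic_affine ha b c (2 * c) d).2 (isPermPoly_sextic_iff.2 fun x y hxy =>
      fieldNine_injective_one c d hb x y (by linear_combination hxy))

theorem isPermPoly_sextic_iff_rowsNine {F : Type*} [Field F] [Fintype F]
    (hq : Fintype.card F = 9) (a₅ a₄ a₃ a₂ a₁ : F) :
    IsPermPoly (sextic a₅ a₄ a₃ a₂ a₁) ↔ RowsNine (sextic a₅ a₄ a₃ a₂ a₁) := by
  have e : F ≃+* FieldNine := FiniteField.ringEquivOfCardEq (by rw [hq, card_fieldNine])
  refine ⟨fun h => of_map_ringEquiv e (fun g hg => RowsNine.map e.symm hg) ?_, fun h => ?_⟩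
  · rw [← isPermPoly_sextic_map e, sextic_map] at h
    rw [sextic_map]
    exact fieldNine_rows h
  · rw [← isPermPoly_sextic_map e]
    exact fieldNine_isPermPoly (h.map e)

end RowsNine

/-! ### The field of 27 elements. -/

section RowTwentySeven

variable {F : Type*} [Field F] [Fintype F] [CharP F 3]

theorem isPermPoly_sextic_iff_row9 (hq : Fintype.card F = 27) (a₅ a₄ a₃ a₂ a₁ : F) :
    IsPermPoly (sextic a₅ a₄ a₃ a₂ a₁) ↔ Row9 (sextic a₅ a₄ a₃ a₂ a₁) := by
  have h3 := three_eq_zero (F := F)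
  constructor
  · intro hf
    by_cases h5 : a₅ = 0
    · subst h5
      exact absurd hf (not_isPermPoly_sextic_zero (v := 0) hq _ _ _ _)
    · obtain ⟨b, c, e, d, rfl, rfl, rfl, rfl⟩ := exists_affine_parameters h5 a₄ a₃ a₂ a₁
      rw [isPermPoly_sextic_affine h5] at hf
      obtain ⟨rfl, rfl, rfl⟩ := eq_of_isPermPoly_sextic_one_of_card hq hf
      refine ⟨a₅, b, h5, ?_⟩
      congr 1
      · ring
      · ring
      · linear_combination a₅ ^ 4 * b * h3
  · rintro ⟨a, b, ha, h⟩
    rw [h]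
    convert (isPermPoly_sextic_affine ha b 0 2 0).2 (isPermPoly_sextic_of_card_twentySeven hq)
      using 2
    · ring
    · ring
    · linear_combination -a ^ 4 * b * h3

end RowTwentySeven

/-! ### Assembling the classification. -/

section Main

variable {F : Type*} [Field F] [Fintype F]

omit [Fintype F] in
theorem isNormalised_sextic {a₅ a₄ a₃ a₂ a₁ : F} (hf : IsPermPoly (sextic a₅ a₄ a₃ a₂ a₁))
    (h : ringChar F ≠ 3 → a₅ = 0) : IsNormalised (sextic a₅ a₄ a₃ a₂ a₁) where
  isPermPoly := hf
  monic := sextic_monic _ _ _ _ _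
  eval_zero := by simp [sextic_eval]
  coeff_pred hd := by
    rw [sextic_natDegree] at hd ⊢
    rw [sextic_coeff_five]
    exact h fun h3 => hd (by rw [h3]; norm_num)

/-- The families of the classification, each over its field. -/
def InTable (f : F[X]) : Prop :=
  (Fintype.card F = 11 ∧ RowsEleven f) ∨ (Fintype.card F = 9 ∧ RowsNine f) ∨
    (Fintype.card F = 27 ∧ Row9 f)

theorem inTable_of_ringChar_eq_three (h3 : ringChar F = 3) (hlt : 6 < Fintype.card F)
    {a₅ a₄ a₃ a₂ a₁ : F} (hf : IsPermPoly (sextic a₅ a₄ a₃ a₂ a₁)) :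
    InTable (sextic a₅ a₄ a₃ a₂ a₁) := by
  have : CharP F 3 := h3 ▸ ringChar.charP F
  obtain ⟨n, -, hn⟩ := FiniteField.card F 3
  obtain ⟨n, hn0⟩ := n
  simp only [PNat.mk_coe] at hn
  rcases n with _ | _ | _ | _ | n
  · omega
  · omega
  · exact .inr (.inl ⟨hn, (isPermPoly_sextic_iff_rowsNine hn _ _ _ _ _).1 hf⟩)
  · exact .inr (.inr ⟨hn, (isPermPoly_sextic_iff_row9 hn _ _ _ _ _).1 hf⟩)
  · exfalso
    obtain ⟨v, hv⟩ : ∃ v, 3 ^ (n + 1) = 2 * v + 1 :=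
      Odd.pow (show Odd 3 by decide)
    have hcard : Fintype.card F = 27 * (2 * v + 1) := by
      rw [hn, ← hv]; ring
    have h30 := three_eq_zero (F := F)
    -- `2v + 1` is a positive power of 3, hence 0 in `F`.
    have hv1 : (v : F) = 1 := by
      have h := congrArg (Nat.cast : ℕ → F) hv
      push_cast at h
      rw [h30, zero_pow (Nat.succ_ne_zero n)] at h
      linear_combination h + (v : F) * h30
    by_cases h5 : a₅ = 0
    · subst h5
      exact not_isPermPoly_sextic_zero hcard _ _ _ _ hf
    · obtain ⟨b, c, e, d, rfl, rfl, rfl, rfl⟩ := exists_affine_parameters h5 a₄ a₃ a₂ a₁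
      rw [isPermPoly_sextic_affine h5] at hf
      exact not_isPermPoly_sextic_one hcard hv1 _ _ _ hf

theorem card_mod_three_ne_zero (h3 : ringChar F ≠ 3) : Fintype.card F % 3 ≠ 0 := by
  intro h
  obtain ⟨n, hp, hn⟩ := FiniteField.card F (ringChar F)
  have hd : 3 ∣ ringChar F ^ (n : ℕ) := hn ▸ Nat.dvd_of_mod_eq_zero h
  exact h3 ((Nat.prime_dvd_prime_iff_eq Nat.prime_three hp).1
    (Nat.prime_three.dvd_of_dvd_pow hd)).symm

theorem inTable_of_ringChar_ne_three (hodd : Odd (Fintype.card F)) (h3 : ringChar F ≠ 3)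
    (hlt : 6 < Fintype.card F) {a b c d : F} (hf : IsPermPoly (sextic 0 a b c d)) :
    InTable (sextic 0 a b c d) := by
  have hm := card_mod_three_ne_zero h3
  rw [Nat.odd_iff] at hodd
  rcases (by omega : Fintype.card F % 6 = 1 ∨ Fintype.card F % 6 = 5) with h | h
  · exact absurd hf (not_isPermPoly_sextic_of_mod_six_eq_one h _ _ _ _ _)
  obtain ⟨k, hk⟩ : ∃ k, Fintype.card F + 1 = 6 * k := ⟨(Fintype.card F + 1) / 6, by omega⟩
  obtain rfl := coeff_four_eq_zero hk (by omega) hf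
  rcases (by omega : Fintype.card F = 11 ∨ Fintype.card F = 17 ∨ 23 ≤ Fintype.card F) with
    h | h | h
  · exact .inl ⟨h, (isPermPoly_sextic_iff_rowsEleven h _ _ _).1 hf⟩
  · exact absurd hf (not_isPermPoly_sextic_of_card_seventeen h _ _ _)
  · exact absurd hf (not_isPermPoly_sextic_of_mod_six_eq_five hk h _ _ _)

theorem not_ringChar_dvd_six (hodd : Odd (Fintype.card F)) (h3 : ringChar F ≠ 3) :
    ¬ ringChar F ∣ 6 := by
  intro h
  obtain ⟨n, hp, hn⟩ := FiniteField.card F (ringChar F)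
  rcases (Nat.Prime.dvd_mul hp).1 (show ringChar F ∣ 2 * 3 from h) with h | h
  · have h2 := (Nat.prime_dvd_prime_iff_eq hp Nat.prime_two).1 h
    rw [hn, h2, Nat.odd_pow_iff n.ne_zero] at hodd
    exact absurd hodd (by decide)
  · exact h3 ((Nat.prime_dvd_prime_iff_eq hp Nat.prime_three).1 h)

theorem isNormalised_iff_inTable (hodd : Odd (Fintype.card F)) (f : F[X]) :
    (IsNormalised f ∧ f.natDegree = 6 ∧ f.natDegree < Fintype.card F) ↔ InTable f := by
  constructor
  · rintro ⟨hf, hd, hlt⟩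
    rw [hd] at hlt
    have hs := eq_sextic hf.monic hd hf.eval_zero
    have hp := hf.isPermPoly
    by_cases h3 : ringChar F = 3
    · rw [hs] at hp ⊢
      exact inTable_of_ringChar_eq_three h3 hlt hp
    · have h5 : f.coeff 5 = 0 := by
        have := hf.coeff_pred
        rw [hd] at this
        exact this (not_ringChar_dvd_six hodd h3)
      rw [h5] at hs
      rw [hs] at hp ⊢
      exact inTable_of_ringChar_ne_three hodd h3 hlt hp
  · rintro (⟨hq, h⟩ | ⟨hq, h⟩ | ⟨hq, h⟩)
    · obtain ⟨b, c, d, rfl⟩ := h.exists_eq_sextic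
      exact ⟨isNormalised_sextic ((isPermPoly_sextic_iff_rowsEleven hq _ _ _).2 h) fun _ => rfl,
        sextic_natDegree _ _ _ _ _, by rw [sextic_natDegree, hq]; norm_num⟩
    · have : CharP F 3 := charP_three_of_card (n := 2) hq
      obtain ⟨a₅, a₄, a₃, a₂, a₁, rfl⟩ := h.exists_eq_sextic
      exact ⟨isNormalised_sextic ((isPermPoly_sextic_iff_rowsNine hq _ _ _ _ _).2 h)
        fun h3 => absurd (ringChar.eq F 3) h3,
        sextic_natDegree _ _ _ _ _, by rw [sextic_natDegree, hq]; norm_num⟩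
    · have : CharP F 3 := charP_three_of_card (n := 3) hq
      obtain ⟨a, b, ha, rfl⟩ := id h
      exact ⟨isNormalised_sextic ((isPermPoly_sextic_iff_row9 hq _ _ _ _ _).2 h)
        fun h3 => absurd (ringChar.eq F 3) h3,
        sextic_natDegree _ _ _ _ _, by rw [sextic_natDegree, hq]; norm_num⟩

/-- An arbitrary example is first made monic with zero constant term; outside characteristic 3 it is
then translated to lose `x^5`. -/
theorem exists_isPermPoly_iff_exists_inTable (hodd : Odd (Fintype.card F)) :
    (∃ f : F[X], IsPermPoly f ∧ f.natDegree = 6 ∧ f.natDegree < Fintype.card F) ↔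
      ∃ f : F[X], InTable f := by
  constructor
  · rintro ⟨f, hf, hd, hlt⟩
    rw [hd] at hlt
    obtain ⟨a₅, a₄, a₃, a₂, a₁, hs⟩ := hf.exists_monic_of_natDegree_six hd
    by_cases h3 : ringChar F = 3
    · exact ⟨_, inTable_of_ringChar_eq_three h3 hlt hs⟩
    · have h6 : (6 : F) ≠ 0 := fun h => not_ringChar_dvd_six hodd h3
        ((ringChar.spec F 6).1 (by exact_mod_cast h))
      obtain ⟨a, b, c, d, h⟩ := hs.exists_sextic_zero h6
      exact ⟨_, inTable_of_ringChar_ne_three hodd h3 hlt h⟩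
  · rintro ⟨f, hf⟩
    obtain ⟨h, h'⟩ := (isNormalised_iff_inTable hodd f).2 hf
    exact ⟨f, h.isPermPoly, h'⟩

theorem exists_inTable_iff :
    (∃ f : F[X], InTable f) ↔
      (Fintype.card F = 9 ∨ Fintype.card F = 11 ∨ Fintype.card F = 27) := by
  constructor
  · rintro ⟨f, ⟨h, -⟩ | ⟨h, -⟩ | ⟨h, -⟩⟩ <;> simp [h]
  · rintro (h | h | h)
    · exact ⟨_, .inr (.inl ⟨h, .inr (.inl ⟨1, 0, one_ne_zero, rfl⟩)⟩)⟩
    · exact ⟨_, .inl ⟨h, .inl (.inl rfl)⟩⟩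
    · exact ⟨_, .inr (.inr ⟨h, 1, 0, one_ne_zero, rfl⟩)⟩

end Main
end DegSix

theorem mainTheorem1 {F : Type*} [Field F] [Fintype F] (hodd : Odd (Fintype.card F)) :
    ((∃ f : F[X], DegSix.IsPermPoly f ∧ f.natDegree = 6 ∧ f.natDegree < Fintype.card F) ↔
      (Fintype.card F = 9 ∨ Fintype.card F = 11 ∨ Fintype.card F = 27)) ∧
    (∀ f : F[X],
      (DegSix.IsNormalised f ∧ f.natDegree = 6 ∧ f.natDegree < Fintype.card F) ↔
        ((Fintype.card F = 11 ∧
            (DegSix.Row1 f ∨ DegSix.Row2 f ∨ DegSix.Row3 f ∨ DegSix.Row4 f)) ∨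
          (Fintype.card F = 9 ∧
            (DegSix.Row5 f ∨ DegSix.Row6 f ∨ DegSix.Row7 f ∨ DegSix.Row8 f)) ∨
          (Fintype.card F = 27 ∧ DegSix.Row9 f))) :=
  ⟨(DegSix.exists_isPermPoly_iff_exists_inTable hodd).trans DegSix.exists_inTable_iff,
    DegSix.isNormalised_iff_inTable hodd⟩
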